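/- Consider the multi-source M/M/1/1 bufferless preemptive system: $N$ independent sources generate updates according to independent Poisson processes of rates $\lambda_1,\dots,\lambda_N>0$ (with $\lambda=\sum_{j=1}^N\lambda_j$), starting at time $0$; the service times of the updates are i.i.d. exponential with rate $\mu>0$, independent of the arrivals. An arriving update, of whatever source, enters service at once; any update still in service is then discarded. An update is successfully received at its completion time if no later update arrives before that time. Let $\Delta_i(t)=t-U_i(t)$ be the age of information (AoI) of source $i$ at time $t\ge 0$, where $U_i(t)$ is the arrival time of the most recently received update of source $i$ by time $t$ (and $U_i(t)=0$ if there is none). Probabilities for the AoI $\Delta_i$ are understood in the long run: $\Pr\{\Delta_i\in B\}=p$ means that $\lim_{t\to\infty}\Pr\{\Delta_i(t)\in B\}=p$ and that, almost surely, the fraction of time in $[0,T]$ during which $\Delta_i(t)\in B$ converges to $p$ as $T\to\infty$. Let $a_i\neq b_i$ be the two roots of $s^2+(\lambda+\mu)s+\lambda_i\mu=0$ (they are real, and they are distinct unless $N=1$ and $\lambda=\mu$, a case that is excluded). Then, for every threshold $w_i>0$, the AoI violation probability of source $i$ is $$P_i^{\mathrm A}(w_i):=\Pr\{\Delta_i>w_i\}=\frac{a_i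 e^{b_i w_i}-b_i e^{a_i w_i}}{a_i-b_i},$$ and the AoI of source $i$ has the probability density function $$f_{\Delta_i}(x)=\begin{cases}\dfrac{\lambda_i\mu}{a_i-b_i}\left(e^{a_i x}-e^{b_i x}\right),& x\ge 0,\\[1ex] 0,& x<0,\end{cases}$$ that is, $f_{\Delta_i}$ is nonnegative with integral $1$ and $\Pr\{\Delta_i\le x\}=\int_{-\infty}^x f_{\Delta_i}(y)\,dy$ for every $x\in\mathbb R$. -/

import Mathlib

open MeasureTheory ProbabilityTheory Filter Topology

namespace AoI

/-- The stochastic data of the multi-source M/M/1/1 system. `X j k` is the `k`-th inter-arrival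
time of source `j` (so that the updates of source `j` form a Poisson process of rate `lam j`), and
`S j k` is the service time requested by the `k`-th update of source `j`. All of these variables
are mutually independent. -/
structure IsMM11 {Ω : Type*} [MeasurableSpace Ω] (P : Measure Ω) {N : ℕ}
    (lam : Fin N → ℝ) (mu : ℝ) (X S : Fin N → ℕ → Ω → ℝ) : Prop where
  law_interarrival : ∀ j k, HasLaw (X j k) (expMeasure (lam j)) P
  law_service : ∀ j k, HasLaw (S j k) (expMeasure mu) P
  indep : iIndepFun (fun s : (Fin N × ℕ) ⊕ (Fin N × ℕ) =>
    Sum.elim (fun p => X p.1 p.2) (fun p => S p.1 p.2) s) P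

/-- Arrival (generation) time of the `k`-th update of source `j`, `k = 0, 1, 2, …`. -/
def arrival {Ω : Type*} {N : ℕ} (X : Fin N → ℕ → Ω → ℝ) (j : Fin N) (k : ℕ) (ω : Ω) : ℝ :=
  ∑ l ∈ Finset.range (k + 1), X j l ω

/-- The time at which the service of the `k`-th update of source `j` is finished, if it is not
preempted: there is no waiting, service starts on arrival. -/
def completion {Ω : Type*} {N : ℕ} (X S : Fin N → ℕ → Ω → ℝ) (j : Fin N) (k : ℕ) (ω : Ω) : ℝ :=
  arrival X j k ω + S j k ω

/-- The `k`-th update of source `j` is successfully received: no update, of whatever source, that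
arrives after it arrives before its service is finished. (Any such arrival would preempt it, and
a preempted update is discarded.) -/
def Received {Ω : Type*} {N : ℕ} (X S : Fin N → ℕ → Ω → ℝ) (j : Fin N) (k : ℕ) (ω : Ω) : Prop :=
  ∀ j' k', arrival X j k ω < arrival X j' k' ω → completion X S j k ω ≤ arrival X j' k' ω

/-- Indices of the updates of source `i` that the monitor has received by time `t`. -/
def receivedBy {Ω : Type*} {N : ℕ} (X S : Fin N → ℕ → Ω → ℝ) (i : Fin N) (t : ℝ) (ω : Ω) :
    Set ℕ :=
  {k | Received X S i k ω ∧ completion X S i k ω ≤ t}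

open Classical in
/-- Generation time of the update of source `i` that was received last by time `t`: the update
with the largest index among those received (received updates leave in the order in which they
arrive). By convention it is `0`, the starting time, as long as nothing has been received. -/
noncomputable def lastGenerated {Ω : Type*} {N : ℕ} (X S : Fin N → ℕ → Ω → ℝ) (i : Fin N)
    (t : ℝ) (ω : Ω) : ℝ :=
  if (receivedBy X S i t ω).Nonempty then arrival X i (sSup (receivedBy X S i t ω)) ω else 0

/-- The instantaneous age of information of source `i` at time `t`. -/
noncomputable def age {Ω : Type*} {N : ℕ} (X S : Fin N → ℕ → Ω → ℝ) (i : Fin N)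
    (t : ℝ) (ω : Ω) : ℝ :=
  t - lastGenerated X S i t ω

/-- `p` is the long-run (stationary) probability that the process `Z` lies in `B`: both the limit
of the probabilities at time `t`, and, almost surely, the long-run fraction of time that `Z`
spends in `B`. -/
structure IsLongRunProb {Ω : Type*} [MeasurableSpace Ω] (P : Measure Ω) (Z : ℝ → Ω → ℝ)
    (B : Set ℝ) (p : ℝ) : Prop where
  tendsto_prob : Tendsto (fun t : ℝ => P.real {ω | Z t ω ∈ B}) atTop (𝓝 p)
  tendsto_fraction : ∀ᵐ ω ∂P,
    Tendsto (fun T : ℝ => volume.real {t : ℝ | 0 ≤ t ∧ t ≤ T ∧ Z t ω ∈ B} / T) atTop (𝓝 p)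

/-- `p` is the violation probability `Pr{Δ_i > w}` of the age of information of source `i`. -/
def IsViolationProb {Ω : Type*} [MeasurableSpace Ω] (P : Measure Ω) {N : ℕ}
    (X S : Fin N → ℕ → Ω → ℝ) (i : Fin N) (w p : ℝ) : Prop :=
  IsLongRunProb P (age X S i) (Set.Ioi w) p

/-- `f` is a probability density function of the (long-run) age of information of source `i`. -/
structure IsAgeDensity {Ω : Type*} [MeasurableSpace Ω] (P : Measure Ω) {N : ℕ}
    (X S : Fin N → ℕ → Ω → ℝ) (i : Fin N) (f : ℝ → ℝ) : Prop where
  measurable : Measurable f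
  nonneg : ∀ x, 0 ≤ f x
  integrable : Integrable f
  integral_eq_one : ∫ x, f x = 1
  cdf : ∀ x, IsLongRunProb P (age X S i) (Set.Iic x) (∫ y in Set.Iic x, f y)

end AoI

/-!
The age of source `i` at time `t` is at most `w < t` exactly when some update of source `i` arrives
at `t - w` or later and is received by `t` (`AoI.age_le_iff`). This event depends only on the
arrivals in `[t - w, t]` and on their service times, and whether an update that arrives in the
window is received does not depend on what happened before. Everything else rests on the Markov
property of the marked Poisson processes, in the form of two measure-preserving maps on the
canonical space `AoI.Config` of realisations.

* `AoI.measurePreserving_spliceAll`: cutting a realisation at a fixed time `u` and continuing it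
  with an independent copy started at `u` does not change its law. The proof is an induction on the
  number of coordinates, by the memorylessness of the exponential law. Cutting at `u = t - w` turns
  the event above into the same event for a system started empty and observed during `[0, w]`.
  Hence its probability is the same for all `t > w`, and the events for windows that do not overlap
  are independent. The time spent above the level `w` during every other block of length `w` is
  therefore a pairwise independent, identically distributed sequence, and the strong law of large
  numbers gives the almost sure limit of the fraction of time.
* `AoI.measurePreserving_restartAt`: a realisation may be generated from the first update of
  source `i`, by splicing the other sources at its arrival time. Let `p w` be the probability that
  nothing of source `i` is received during `[0, w]` when the system starts empty, and `q v` the same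
  probability when an update of source `i` has just entered service. Conditioning on the next
  arrival of source `i` gives two renewal equations for `p` and `q`
  (`AoI.systemLaw_not_delivers_eq`, `AoI.busySilence_eq`). They reduce to a linear system of two
  differential equations with characteristic polynomial `s ^ 2 + (λ + μ) s + λᵢ μ`, and
  `AoI.renewal_solution` solves it.

The limits of the violation probabilities are thus the values `p w`, and the density is `-p'`.
-/

namespace AoI

/-! ### Memorylessness of the exponential law -/

theorem expMeasure_apply (r : ℝ) {A : Set ℝ} (hA : MeasurableSet A) :
    expMeasure r A = ∫⁻ x, A.indicator (exponentialPDF r) x := by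
  rw [lintegral_indicator hA]
  exact withDensity_apply _ hA

theorem exponentialPDF_add {r u y : ℝ} (hu : 0 ≤ u) (hy : 0 ≤ y) :
    exponentialPDF r (u + y) = ENNReal.ofReal (Real.exp (-(r * u))) * exponentialPDF r y := by
  rw [exponentialPDF_of_nonneg (add_nonneg hu hy), exponentialPDF_of_nonneg hy,
    ← ENNReal.ofReal_mul (Real.exp_pos _).le]
  congr 1
  rw [mul_add, neg_add, Real.exp_add]
  ring

/-- Memorylessness: above `u`, the exponential law is a multiple of its own translate by `u`. -/
theorem expMeasure_inter_Ici (r : ℝ) {u : ℝ} (hu : 0 ≤ u) {A : Set ℝ} (hA : MeasurableSet A) :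
    expMeasure r (A ∩ Set.Ici u) =
      ENNReal.ofReal (Real.exp (-(r * u))) * expMeasure r ((fun x => u + x) ⁻¹' A) := by
  have hA' : MeasurableSet ((fun x => u + x) ⁻¹' A) := hA.preimage (measurable_const_add u)
  rw [expMeasure_apply r (hA.inter measurableSet_Ici), expMeasure_apply r hA',
    ← lintegral_const_mul' _ _ ENNReal.ofReal_ne_top, ← lintegral_add_left_eq_self _ u]
  refine lintegral_congr fun y => ?_
  rcases lt_or_ge y 0 with hy | hy
  · rw [Set.indicator_of_notMem (by simp [hy])]
    simp [exponentialPDF_of_neg hy]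
  · by_cases hyA : u + y ∈ A
    · rw [Set.indicator_of_mem (show u + y ∈ A ∩ Set.Ici u from ⟨hyA, by simpa using hy⟩),
        Set.indicator_of_mem (show y ∈ (fun x => u + x) ⁻¹' A from hyA), exponentialPDF_add hu hy]
    · rw [Set.indicator_of_notMem (fun h : u + y ∈ A ∩ Set.Ici u => hyA h.1),
        Set.indicator_of_notMem (show y ∉ (fun x => u + x) ⁻¹' A from hyA), mul_zero]

theorem expMeasure_Ici {r : ℝ} (hr : 0 < r) {u : ℝ} (hu : 0 ≤ u) :
    expMeasure r (Set.Ici u) = ENNReal.ofReal (Real.exp (-(r * u))) := by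
  have := isProbabilityMeasure_expMeasure hr
  simpa using expMeasure_inter_Ici r hu MeasurableSet.univ

theorem expMeasure_singleton (r x : ℝ) : expMeasure r {x} = 0 := by
  rw [expMeasure, gammaMeasure, withDensity_apply _ (measurableSet_singleton x)]
  simp

theorem expMeasure_ae_pos {r : ℝ} (hr : 0 < r) : ∀ᵐ x ∂expMeasure r, 0 < x := by
  have := isProbabilityMeasure_expMeasure hr
  have h : expMeasure r (Set.Ici 0) = 1 := by simp [expMeasure_Ici hr le_rfl]
  have h0 : ∀ᵐ x ∂expMeasure r, x ∈ Set.Ici (0 : ℝ) := (prob_compl_eq_zero_iff measurableSet_Ici).2 h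
  have h1 : ∀ᵐ x ∂expMeasure r, x ≠ 0 := by simp [ae_iff, expMeasure_singleton]
  filter_upwards [h0, h1] with x hx hx'
  exact lt_of_le_of_ne hx (Ne.symm hx')

theorem lintegral_expMeasure (r : ℝ) {f : ℝ → ENNReal} (hf : Measurable f) :
    ∫⁻ x, f x ∂expMeasure r =
      ∫⁻ x in Set.Ioi 0, ENNReal.ofReal (r * Real.exp (-(r * x))) * f x := by
  have h : ∫⁻ x, f x ∂expMeasure r = ∫⁻ x, exponentialPDF r x * f x :=
    lintegral_withDensity_eq_lintegral_mul _
      (measurable_exponentialPDFReal r).ennreal_ofReal hf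
  rw [h, setLIntegral_congr Ioi_ae_eq_Ici, ← lintegral_indicator measurableSet_Ici]
  refine lintegral_congr fun x => ?_
  by_cases hx : 0 ≤ x
  · rw [Set.indicator_of_mem (by simpa using hx), exponentialPDF_of_nonneg hx]
  · rw [Set.indicator_of_notMem (by simpa using hx), exponentialPDF_of_neg (not_le.1 hx), zero_mul]

/-! ### Cutting and splicing one marked Poisson process -/

/-- A sequence `z : ℕ → ℝ × ℝ` encodes a marked point process on the half-line: `(z k).1` is the
`k`-th inter-arrival time and `(z k).2` the mark of the `k`-th point. `splice u z z'` keeps the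
points of `z` that lie strictly before `u` and continues with the points of `z'`, translated
by `u`. -/
noncomputable def splice (u : ℝ) (z z' : ℕ → ℝ × ℝ) : ℕ → ℝ × ℝ
  | 0 => if u ≤ (z 0).1 then (u + (z' 0).1, (z' 0).2) else z 0
  | k + 1 => if u ≤ (z 0).1 then z' (k + 1) else splice (u - (z 0).1) (fun l => z (l + 1)) z' k

/-- Prepend one entry to a sequence. -/
def cons {α : Type*} (e : α) (y : ℕ → α) : ℕ → α
  | 0 => e
  | k + 1 => y k

theorem measurable_cons {α : Type*} [MeasurableSpace α] :
    Measurable fun p : α × (ℕ → α) => cons p.1 p.2 := by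
  refine measurable_pi_iff.2 fun k => ?_
  cases k with
  | zero => exact measurable_fst
  | succ k => exact (measurable_pi_apply k).comp measurable_snd

theorem measurable_splice_uncurry :
    Measurable fun p : ℝ × (ℕ → ℝ × ℝ) × (ℕ → ℝ × ℝ) => splice p.1 p.2.1 p.2.2 := by
  refine measurable_pi_iff.2 fun k => ?_
  induction k with
  | zero =>
    refine Measurable.ite (measurableSet_le (by fun_prop) (by fun_prop)) (by fun_prop)
      (by fun_prop)
  | succ k ih =>
    refine Measurable.ite (measurableSet_le (by fun_prop) (by fun_prop)) (by fun_prop) ?_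
    exact ih.comp (f := fun p : ℝ × (ℕ → ℝ × ℝ) × (ℕ → ℝ × ℝ) =>
      (p.1 - (p.2.1 0).1, (fun l => p.2.1 (l + 1)), p.2.2)) (by fun_prop)

theorem measurable_splice (u : ℝ) :
    Measurable fun p : (ℕ → ℝ × ℝ) × (ℕ → ℝ × ℝ) => splice u p.1 p.2 :=
  measurable_splice_uncurry.comp (f := fun p : (ℕ → ℝ × ℝ) × (ℕ → ℝ × ℝ) => (u, p))
    (by fun_prop)

/-- A measure on sequences is the product measure as soon as it is so on initial segments. -/
theorem eq_infinitePi_of_initial {α : Type*} [MeasurableSpace α] (ρ : Measure α)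
    [IsProbabilityMeasure ρ] (ν : Measure (ℕ → α))
    (h : ∀ (m : ℕ) (t : ℕ → Set α), (∀ k, MeasurableSet (t k)) →
      ν {z | ∀ k < m, z k ∈ t k} = ∏ k ∈ Finset.range m, ρ (t k)) :
    ν = Measure.infinitePi fun _ => ρ := by
  classical
  refine Measure.eq_infinitePi _ fun s t ht => ?_
  obtain ⟨m, hm⟩ : ∃ m, s ⊆ Finset.range m := s.exists_nat_subset_range
  have h1 := h m (fun k => if k ∈ s then t k else Set.univ)
    (fun k => by split_ifs <;> simp [ht])
  have h2 : {z : ℕ → α | ∀ k < m, z k ∈ (if k ∈ s then t k else Set.univ)} = Set.pi s t := by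
    ext z
    simp only [Set.mem_ofPred_eq, Set.mem_pi, Finset.mem_coe]
    constructor
    · intro hz k hk
      simpa [hk] using hz k (Finset.mem_range.1 (hm hk))
    · intro hz k _
      by_cases hk : k ∈ s
      · simpa [hk] using hz k hk
      · simp [hk]
  rw [h2] at h1
  rw [h1, ← Finset.prod_subset hm (fun k _ hk => by simp [hk])]
  exact Finset.prod_congr rfl fun k hk => by simp [hk]

theorem infinitePi_initial {α : Type*} [MeasurableSpace α] (ρ : Measure α)
    [IsProbabilityMeasure ρ] (m : ℕ) (t : ℕ → Set α) (ht : ∀ k, MeasurableSet (t k)) :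
    Measure.infinitePi (fun _ : ℕ => ρ) {z | ∀ k < m, z k ∈ t k} =
      ∏ k ∈ Finset.range m, ρ (t k) := by
  rw [← Measure.infinitePi_pi (fun _ : ℕ => ρ) (fun k _ => ht k)]
  congr 1
  ext z
  simp [Set.mem_pi]

theorem measurableSet_initial {α : Type*} [MeasurableSpace α] (m : ℕ) {t : ℕ → Set α}
    (ht : ∀ k, MeasurableSet (t k)) : MeasurableSet {z : ℕ → α | ∀ k < m, z k ∈ t k} := by
  simp only [Set.ofPred_forall]
  exact MeasurableSet.iInter fun k => MeasurableSet.iInter fun _ =>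
    (ht k).preimage (measurable_pi_apply k)

theorem cons_mem_initial_iff {α : Type*} (e : α) (y : ℕ → α) (m : ℕ) (t : ℕ → Set α) :
    (∀ k < m + 1, cons e y k ∈ t k) ↔ e ∈ t 0 ∧ ∀ k < m, y k ∈ t (k + 1) := by
  constructor
  · exact fun h => ⟨h 0 (by omega), fun k hk => h (k + 1) (by omega)⟩
  · rintro ⟨h0, h1⟩ k hk
    cases k with
    | zero => exact h0
    | succ k => exact h1 k (by omega)

theorem measurePreserving_cons {α : Type*} [MeasurableSpace α] (ρ : Measure α)
    [IsProbabilityMeasure ρ] :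
    MeasurePreserving (fun p : α × (ℕ → α) => cons p.1 p.2)
      (ρ.prod (Measure.infinitePi fun _ => ρ)) (Measure.infinitePi fun _ => ρ) := by
  refine ⟨measurable_cons, eq_infinitePi_of_initial ρ _ fun m t ht => ?_⟩
  rw [Measure.map_apply measurable_cons (measurableSet_initial m ht)]
  cases m with
  | zero => simp
  | succ m =>
    have : (fun p : α × (ℕ → α) => cons p.1 p.2) ⁻¹' {z | ∀ k < m + 1, z k ∈ t k} =
        t 0 ×ˢ {z | ∀ k < m, z k ∈ t (k + 1)} := by
      ext p
      exact cons_mem_initial_iff p.1 p.2 m t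
    rw [this, Measure.prod_prod, infinitePi_initial ρ m _ fun k => ht (k + 1),
      Finset.prod_range_succ', mul_comm]

theorem splice_cons_of_le {u : ℝ} {e : ℝ × ℝ} (h : u ≤ e.1) (y z' : ℕ → ℝ × ℝ) :
    splice u (cons e y) z' = cons (u + (z' 0).1, (z' 0).2) fun k => z' (k + 1) := by
  funext k
  cases k <;> simp [splice, cons, h]

theorem splice_cons_of_lt {u : ℝ} {e : ℝ × ℝ} (h : e.1 < u) (y z' : ℕ → ℝ × ℝ) :
    splice u (cons e y) z' = cons e (splice (u - e.1) y z') := by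
  funext k
  cases k <;> simp [splice, cons, not_le.2 h]

section Splice

variable {r : ℝ} {σ : Measure ℝ}

theorem prod_expMeasure_inter [IsProbabilityMeasure σ] (hr : 0 < r) {u : ℝ} (hu : 0 ≤ u)
    {A : Set (ℝ × ℝ)} (hA : MeasurableSet A) :
    ((expMeasure r).prod σ) (A ∩ {e | u ≤ e.1}) =
      ((expMeasure r).prod σ) {e | u ≤ e.1} *
        ((expMeasure r).prod σ) {e | (u + e.1, e.2) ∈ A} := by
  have := isProbabilityMeasure_expMeasure hr
  have hm : MeasurableSet {e : ℝ × ℝ | u ≤ e.1} := measurableSet_le measurable_const measurable_fst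
  have hA' : MeasurableSet {e : ℝ × ℝ | (u + e.1, e.2) ∈ A} :=
    hA.preimage (f := fun e : ℝ × ℝ => (u + e.1, e.2)) (by fun_prop)
  have h0 : ((expMeasure r).prod σ) {e | u ≤ e.1} = ENNReal.ofReal (Real.exp (-(r * u))) := by
    have : {e : ℝ × ℝ | u ≤ e.1} = Set.Ici u ×ˢ Set.univ := by ext e; simp
    rw [this, Measure.prod_prod, expMeasure_Ici hr hu, measure_univ, mul_one]
  rw [h0, Measure.prod_apply_symm (hA.inter hm), Measure.prod_apply_symm hA',
    ← lintegral_const_mul' _ _ ENNReal.ofReal_ne_top]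
  refine lintegral_congr fun s => ?_
  exact expMeasure_inter_Ici r hu (hA.preimage (f := fun x => (x, s)) (by fun_prop))

/-- The first `m` entries of a spliced sequence are independent with the original law. The
induction on `m` needs all cutting times at once, since dropping the first entry moves the cut. -/
theorem splice_initial [IsProbabilityMeasure σ] (hr : 0 < r) (m : ℕ) :
    ∀ u : ℝ, 0 ≤ u → ∀ t : ℕ → Set (ℝ × ℝ), (∀ k, MeasurableSet (t k)) →
      ((Measure.infinitePi fun _ : ℕ => (expMeasure r).prod σ).prod
        (Measure.infinitePi fun _ : ℕ => (expMeasure r).prod σ))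
        {p | ∀ k < m, splice u p.1 p.2 k ∈ t k} =
      ∏ k ∈ Finset.range m, ((expMeasure r).prod σ) (t k) := by
  have := isProbabilityMeasure_expMeasure hr
  set ρ := (expMeasure r).prod σ with hρ
  induction m with
  | zero => intro u _ t _; simp
  | succ m ih =>
    intro u hu t ht
    have hset : MeasurableSet {p : (ℕ → ℝ × ℝ) × (ℕ → ℝ × ℝ) |
        ∀ k < m + 1, splice u p.1 p.2 k ∈ t k} :=
      (measurableSet_initial (m + 1) ht).preimage (measurable_splice u)
    have hle : MeasurableSet {e : ℝ × ℝ | u ≤ e.1} :=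
      measurableSet_le measurable_const measurable_fst
    have hsh : MeasurableSet {e : ℝ × ℝ | (u + e.1, e.2) ∈ t 0} :=
      (ht 0).preimage (f := fun e : ℝ × ℝ => (u + e.1, e.2)) (by fun_prop)
    have hmp := (measurePreserving_cons ρ).prod
      (MeasurePreserving.id (Measure.infinitePi fun _ : ℕ => ρ))
    rw [← hmp.measure_preimage hset.nullMeasurableSet,
      ← (measurePreserving_prodAssoc ρ (Measure.infinitePi fun _ : ℕ => ρ)
        (Measure.infinitePi fun _ : ℕ => ρ)).symm.measure_preimage
        (hset.preimage hmp.measurable).nullMeasurableSet,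
      Measure.prod_apply ((hset.preimage hmp.measurable).preimage (by fun_prop))]
    set c := ∏ k ∈ Finset.range m, ρ (t (k + 1)) with hc
    -- Given the first entry `e`, either the cut is before it, and the second sequence takes over,
    -- or after it, and the induction hypothesis applies to the tail.
    have key : ∀ e : ℝ × ℝ, 0 < e.1 →
        ((Measure.infinitePi fun _ : ℕ => ρ).prod (Measure.infinitePi fun _ : ℕ => ρ))
          (Prod.mk e ⁻¹' (MeasurableEquiv.prodAssoc.symm ⁻¹'
            (Prod.map (fun p : (ℝ × ℝ) × (ℕ → ℝ × ℝ) => cons p.1 p.2) id ⁻¹'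
              {p | ∀ k < m + 1, splice u p.1 p.2 k ∈ t k}))) =
        ({e | u ≤ e.1}.indicator (fun _ => ρ {e | (u + e.1, e.2) ∈ t 0} * c) e +
          (t 0 \ {e | u ≤ e.1}).indicator (fun _ => c) e) := by
      intro e he
      by_cases hue : u ≤ e.1
      · rw [Set.indicator_of_mem (by exact hue), Set.indicator_of_notMem (fun h => h.2 hue),
          add_zero]
        have : (Prod.mk e ⁻¹' (MeasurableEquiv.prodAssoc.symm ⁻¹'
            (Prod.map (fun p : (ℝ × ℝ) × (ℕ → ℝ × ℝ) => cons p.1 p.2) id ⁻¹'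
              {p | ∀ k < m + 1, splice u p.1 p.2 k ∈ t k}))) =
            Set.univ ×ˢ {z : ℕ → ℝ × ℝ | ∀ k < m + 1, z k ∈
              cons {e | (u + e.1, e.2) ∈ t 0} (fun k => t (k + 1)) k} := by
          ext p
          change (∀ k < m + 1, splice u (cons e p.1) p.2 k ∈ t k) ↔ _
          rw [splice_cons_of_le hue, cons_mem_initial_iff]
          simp only [Set.mem_prod, Set.mem_univ, true_and, Set.mem_ofPred_eq]
          constructor
          · rintro ⟨h0, h1⟩ k hk
            cases k with
            | zero => exact h0
            | succ k => exact h1 k (by omega)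
          · exact fun h => ⟨h 0 (by omega), fun k hk => h (k + 1) (by omega)⟩
        rw [this, Measure.prod_prod, measure_univ, one_mul, infinitePi_initial ρ,
          Finset.prod_range_succ', mul_comm]
        · rfl
        · rintro (_ | k)
          · exact hsh
          · exact ht (k + 1)
      · rw [Set.indicator_of_notMem (by exact hue), zero_add]
        push Not at hue
        by_cases he0 : e ∈ t 0
        · rw [Set.indicator_of_mem (show e ∈ t 0 \ {e | u ≤ e.1} from ⟨he0, not_le.2 hue⟩), hc,
            ← ih (u - e.1) (by linarith) (fun k => t (k + 1)) fun k => ht (k + 1)]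
          congr 1
          ext p
          change (∀ k < m + 1, splice u (cons e p.1) p.2 k ∈ t k) ↔ _
          rw [splice_cons_of_lt hue, cons_mem_initial_iff]
          simp [he0]
        · rw [Set.indicator_of_notMem (fun h => he0 h.1)]
          refine measure_mono_null (fun p hp => ?_) measure_empty
          change ∀ k < m + 1, splice u (cons e p.1) p.2 k ∈ t k at hp
          rw [splice_cons_of_lt hue, cons_mem_initial_iff] at hp
          exact he0 hp.1
    have hpos : ∀ᵐ e ∂ρ, 0 < e.1 :=
      (measurePreserving_fst (μ := expMeasure r) (ν := σ)).quasiMeasurePreserving.ae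
        (expMeasure_ae_pos hr)
    rw [lintegral_congr_ae (hpos.mono key), lintegral_add_left (measurable_const.indicator hle),
      lintegral_indicator_const hle, lintegral_indicator_const ((ht 0).diff hle),
      Finset.prod_range_succ', ← hc]
    have h1 := prod_expMeasure_inter (σ := σ) hr hu (ht 0)
    rw [← hρ] at h1
    rw [← measure_inter_add_sdiff (t 0) hle, h1]
    ring

/-- The Markov property of a marked Poisson process at a fixed time `u`: replacing its points after
`u` by those of an independent copy started at `u` does not change its law. -/
theorem measurePreserving_splice [IsProbabilityMeasure σ] (hr : 0 < r) {u : ℝ} (hu : 0 ≤ u) :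
    MeasurePreserving (fun p : (ℕ → ℝ × ℝ) × (ℕ → ℝ × ℝ) => splice u p.1 p.2)
      ((Measure.infinitePi fun _ : ℕ => (expMeasure r).prod σ).prod
        (Measure.infinitePi fun _ : ℕ => (expMeasure r).prod σ))
      (Measure.infinitePi fun _ : ℕ => (expMeasure r).prod σ) := by
  have := isProbabilityMeasure_expMeasure hr
  refine ⟨measurable_splice u, eq_infinitePi_of_initial _ _ fun m t ht => ?_⟩
  rw [Measure.map_apply (measurable_splice u) (measurableSet_initial m ht)]
  exact splice_initial hr m u hu t ht

end Splice

/-! ### Configurations as sets of marked points -/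

/-- The position of the `k`-th point of the marked point process encoded by `z`. -/
def time (z : ℕ → ℝ × ℝ) (k : ℕ) : ℝ := ∑ l ∈ Finset.range (k + 1), (z l).1

/-- The set of marked points, as pairs (position, mark), encoded by `z`. -/
def pts (z : ℕ → ℝ × ℝ) : Set (ℝ × ℝ) := Set.range fun k => (time z k, (z k).2)

theorem time_zero (z : ℕ → ℝ × ℝ) : time z 0 = (z 0).1 := by simp [time]

theorem time_cons_succ (e : ℝ × ℝ) (y : ℕ → ℝ × ℝ) (k : ℕ) :
    time (cons e y) (k + 1) = e.1 + time y k := by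
  rw [time, Finset.sum_range_succ', add_comm]
  rfl

theorem time_strictMono {z : ℕ → ℝ × ℝ} (hz : ∀ k, 0 < (z k).1) : StrictMono (time z) :=
  strictMono_nat_of_lt_succ fun k => by
    rw [time, time, Finset.sum_range_succ _ (k + 1)]
    linarith [hz (k + 1)]

theorem first_le_time {z : ℕ → ℝ × ℝ} (hz : ∀ k, 0 < (z k).1) (k : ℕ) : (z 0).1 ≤ time z k := by
  rw [← time_zero]
  exact (time_strictMono hz).monotone (Nat.zero_le k)

theorem pts_fst_ge {z : ℕ → ℝ × ℝ} (hz : ∀ k, 0 < (z k).1) {p : ℝ × ℝ} (hp : p ∈ pts z) :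
    (z 0).1 ≤ p.1 := by
  obtain ⟨k, rfl⟩ := hp
  exact first_le_time hz k

theorem cons_head_tail {α : Type*} (z : ℕ → α) : cons (z 0) (fun k => z (k + 1)) = z := by
  funext k
  cases k <;> rfl

theorem mem_pts_cons {e p : ℝ × ℝ} {y : ℕ → ℝ × ℝ} :
    p ∈ pts (cons e y) ↔ p = e ∨ ∃ q ∈ pts y, p = (e.1 + q.1, q.2) := by
  constructor
  · rintro ⟨k, rfl⟩
    cases k with
    | zero => exact Or.inl (by simp [time, cons])
    | succ k => exact Or.inr ⟨_, ⟨k, rfl⟩, by simp [time_cons_succ, cons]⟩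
  · rintro (rfl | ⟨_, ⟨k, rfl⟩, rfl⟩)
    · exact ⟨0, by simp [time, cons]⟩
    · exact ⟨k + 1, by simp [time_cons_succ, cons]⟩

theorem mem_pts_splice_of_le_first {z z' : ℕ → ℝ × ℝ} {u : ℝ} (hz : ∀ k, 0 < (z k).1)
    (hu : u ≤ (z 0).1) {p : ℝ × ℝ} :
    p ∈ pts (splice u z z') ↔
      (p ∈ pts z ∧ p.1 < u) ∨ ∃ q ∈ pts z', p = (u + q.1, q.2) := by
  have h1 : splice u z z' = cons (u + (z' 0).1, (z' 0).2) fun k => z' (k + 1) := by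
    conv_lhs => rw [← cons_head_tail z]
    exact splice_cons_of_le hu _ _
  have h2 : ∀ q, q ∈ pts z' ↔
      q = z' 0 ∨ ∃ q' ∈ pts (fun k => z' (k + 1)), q = ((z' 0).1 + q'.1, q'.2) := by
    intro q
    conv_lhs => rw [← cons_head_tail z']
    exact mem_pts_cons
  rw [h1, mem_pts_cons]
  constructor
  · rintro (rfl | ⟨q, hq, rfl⟩)
    · exact Or.inr ⟨z' 0, (h2 _).2 (Or.inl rfl), rfl⟩
    · exact Or.inr ⟨_, (h2 _).2 (Or.inr ⟨q, hq, rfl⟩), by simp [add_assoc]⟩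
  · rintro (⟨hp, hpu⟩ | ⟨q, hq, rfl⟩)
    · exact absurd (pts_fst_ge hz hp) (by linarith)
    · rcases (h2 q).1 hq with rfl | ⟨q', hq', rfl⟩
      · exact Or.inl rfl
      · exact Or.inr ⟨q', hq', by simp [add_assoc]⟩

/-- The points of `splice u z z'`: the hypothesis `u ≤ time z n` says that finitely many points
of `z` precede `u`. -/
theorem mem_pts_splice {z' : ℕ → ℝ × ℝ} {p : ℝ × ℝ} {n : ℕ} {u : ℝ} {z : ℕ → ℝ × ℝ}
    (hz : ∀ k, 0 < (z k).1) (hu : u ≤ time z n) :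
    p ∈ pts (splice u z z') ↔
      (p ∈ pts z ∧ p.1 < u) ∨ ∃ q ∈ pts z', p = (u + q.1, q.2) := by
  induction n generalizing p u z with
  | zero => exact mem_pts_splice_of_le_first hz (by rwa [time_zero] at hu)
  | succ n ih =>
    obtain ⟨e, y, rfl⟩ : ∃ e y, z = cons e y := ⟨_, _, (cons_head_tail z).symm⟩
    rcases le_or_gt u e.1 with hue | hue
    · exact mem_pts_splice_of_le_first hz hue
    · rw [time_cons_succ] at hu
      rw [splice_cons_of_lt hue, mem_pts_cons, mem_pts_cons]
      have hy : ∀ k, 0 < (y k).1 := fun k => hz (k + 1)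
      have hy' : u - e.1 ≤ time y n := by linarith
      constructor
      · rintro (rfl | ⟨q, hq, rfl⟩)
        · exact Or.inl ⟨Or.inl rfl, hue⟩
        · rcases (ih hy hy').1 hq with ⟨h, h'⟩ | ⟨q', hq', rfl⟩
          · exact Or.inl ⟨Or.inr ⟨q, h, rfl⟩, by simp only; linarith⟩
          · exact Or.inr ⟨q', hq', by simp only [Prod.mk.injEq, and_true]; ring⟩
      · rintro (⟨rfl | ⟨q, hq, rfl⟩, hpu⟩ | ⟨q, hq, rfl⟩)
        · exact Or.inl rfl
        · exact Or.inr ⟨q, (ih hy hy').2 (Or.inl ⟨hq, by simp only at hpu; linarith⟩), rfl⟩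
        · exact Or.inr ⟨_, (ih hy hy').2 (Or.inr ⟨q, hq, rfl⟩),
            by simp only [Prod.mk.injEq, and_true]; ring⟩

/-! ### Deliveries in a configuration -/

/-- A realisation of the system: inter-arrival time and service time of each update of each
source. -/
abbrev Config (N : ℕ) : Type := Fin N → ℕ → ℝ × ℝ

variable {N : ℕ}

/-- The regular configurations, which make up almost all of them: times are positive and no
accumulation of arrivals occurs. -/
structure Regular (z : Config N) : Prop where
  time_pos : ∀ j k, 0 < (z j k).1
  mark_pos : ∀ j k, 0 < (z j k).2
  unbounded : ∀ j u, ∃ n, u ≤ time (z j) n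

/-- Coordinatewise splicing of all sources at the same time `u`. -/
noncomputable def spliceAll (u : ℝ) (z z' : Config N) : Config N :=
  fun j => splice u (z j) (z' j)

/-- The configuration whose source `i` starts with the update `e` and whose points after that
update are those of `z'`; the other sources follow `z` up to then. -/
noncomputable def restartAt (i : Fin N) (e : ℝ × ℝ) (z z' : Config N) : Config N :=
  fun j => if j = i then cons e (z' i) else splice e.1 (z j) (z' j)

/-- An update that arrives at `p.1` and requests the service time `p.2` is not preempted in `z`. -/
def Completes (z : Config N) (p : ℝ × ℝ) : Prop :=
  ∀ j, ∀ q ∈ pts (z j), p.1 < q.1 → p.1 + p.2 ≤ q.1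

/-- Some update of source `i` arrives at time `c` or later and is received by time `t`. -/
def Delivers (z : Config N) (i : Fin N) (c t : ℝ) : Prop :=
  ∃ p ∈ pts (z i), Completes z p ∧ c ≤ p.1 ∧ p.1 + p.2 ≤ t

theorem Regular.pts_pos {z : Config N} (hz : Regular z) {j : Fin N} {p : ℝ × ℝ}
    (hp : p ∈ pts (z j)) : 0 < p.1 ∧ 0 < p.2 := by
  refine ⟨(hz.time_pos j 0).trans_le (pts_fst_ge (hz.time_pos j) hp), ?_⟩
  obtain ⟨k, rfl⟩ := hp
  exact hz.mark_pos j k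

theorem Regular.mem_pts_splice {z : Config N} (hz : Regular z) {z' : ℕ → ℝ × ℝ} {j : Fin N}
    {p : ℝ × ℝ} {u : ℝ} :
    p ∈ pts (splice u (z j) z') ↔
      (p ∈ pts (z j) ∧ p.1 < u) ∨ ∃ q ∈ pts z', p = (u + q.1, q.2) :=
  let ⟨_, hn⟩ := hz.unbounded j u
  AoI.mem_pts_splice (hz.time_pos j) hn

/-- After the splicing time, the spliced system is the second one started afresh. -/
theorem delivers_spliceAll_add {z z' : Config N} (hz : Regular z) (hz' : Regular z') {i : Fin N}
    {u a b : ℝ} (ha : 0 ≤ a) :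
    Delivers (spliceAll u z z') i (u + a) (u + b) ↔ Delivers z' i a b := by
  constructor
  · rintro ⟨p, hp, hc, h1, h2⟩
    rcases hz.mem_pts_splice.1 hp with ⟨-, h⟩ | ⟨q, hq, rfl⟩
    · linarith
    · simp only at h1 h2
      refine ⟨q, hq, fun j q' hq' hlt => ?_, by linarith, by linarith⟩
      have := hc j (u + q'.1, q'.2) (hz.mem_pts_splice.2 (Or.inr ⟨q', hq', rfl⟩))
        (by simp only; linarith)
      simp only at this
      linarith
  · rintro ⟨p, hp, hc, h1, h2⟩
    refine ⟨(u + p.1, p.2), hz.mem_pts_splice.2 (Or.inr ⟨p, hp, rfl⟩), fun j q hq hlt => ?_,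
      by simp only; linarith, by simp only; linarith⟩
    have hp0 := (hz'.pts_pos hp).1
    simp only at hlt
    rcases hz.mem_pts_splice.1 hq with ⟨-, h⟩ | ⟨q', hq', rfl⟩
    · linarith
    · have := hc j q' hq' (by linarith)
      simp only
      linarith

/-- Up to the splicing time, the spliced system is the first one. -/
theorem delivers_spliceAll_of_le {z z' : Config N} (hz : Regular z) (hz' : Regular z') {i : Fin N}
    {u c t : ℝ} (htu : t ≤ u) :
    Delivers (spliceAll u z z') i c t ↔ Delivers z i c t := by
  constructor
  · rintro ⟨p, hp, hc, h1, h2⟩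
    rcases hz.mem_pts_splice.1 hp with ⟨hp, h⟩ | ⟨q, hq, rfl⟩
    · refine ⟨p, hp, fun j q hq hlt => ?_, h1, h2⟩
      rcases lt_or_ge q.1 u with hqu | hqu
      · exact hc j q (hz.mem_pts_splice.2 (Or.inl ⟨hq, hqu⟩)) hlt
      · linarith
    · have := hz'.pts_pos hq
      simp only at h2
      linarith
  · rintro ⟨p, hp, hc, h1, h2⟩
    have hp0 := hz.pts_pos hp
    refine ⟨p, hz.mem_pts_splice.2 (Or.inl ⟨hp, by linarith⟩), fun j q hq hlt => ?_, h1, h2⟩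
    rcases hz.mem_pts_splice.1 hq with ⟨hq, -⟩ | ⟨q', hq', rfl⟩
    · exact hc j q hq hlt
    · have := hz'.pts_pos hq'
      simp only
      linarith

/-- The delivery event for a system in which, at time `0`, an update of source `i` with service
time `s` has just arrived and all later arrivals follow `z`: an update of source `i` is received
by time `v`. -/
def DeliversFrom (i : Fin N) (s v : ℝ) (z : Config N) : Prop :=
  (s ≤ v ∧ ∀ j, s ≤ (z j 0).1) ∨ Delivers z i 0 v

theorem mem_pts_restartAt_self {i : Fin N} {e p : ℝ × ℝ} {z z' : Config N} :
    p ∈ pts (restartAt i e z z' i) ↔ p = e ∨ ∃ q ∈ pts (z' i), p = (e.1 + q.1, q.2) := by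
  rw [restartAt, if_pos rfl, mem_pts_cons]

theorem mem_pts_restartAt_of_ne {i j : Fin N} (hj : j ≠ i) {e p : ℝ × ℝ} {z z' : Config N}
    (hz : Regular z) :
    p ∈ pts (restartAt i e z z' j) ↔
      (p ∈ pts (z j) ∧ p.1 < e.1) ∨ ∃ q ∈ pts (z' j), p = (e.1 + q.1, q.2) := by
  rw [restartAt, if_neg hj, hz.mem_pts_splice]

/-- A point of the restarted configuration that lies after the first update `e` of source `i`
comes from `z'`. -/
theorem exists_of_mem_pts_restartAt {i j : Fin N} {e p : ℝ × ℝ} {z z' : Config N}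
    (hz : Regular z) (hp : p ∈ pts (restartAt i e z z' j)) (h : e.1 < p.1) :
    ∃ q ∈ pts (z' j), p = (e.1 + q.1, q.2) := by
  by_cases hj : j = i
  · subst hj
    rcases mem_pts_restartAt_self.1 hp with rfl | h'
    · exact absurd h (lt_irrefl _)
    · exact h'
  · rcases (mem_pts_restartAt_of_ne hj hz).1 hp with ⟨-, h'⟩ | h'
    · linarith
    · exact h'

theorem mem_pts_restartAt_of_mem {i j : Fin N} {e q : ℝ × ℝ} {z z' : Config N}
    (hz : Regular z) (hq : q ∈ pts (z' j)) : (e.1 + q.1, q.2) ∈ pts (restartAt i e z z' j) := by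
  by_cases hj : j = i
  · subst hj
    exact mem_pts_restartAt_self.2 (Or.inr ⟨q, hq, rfl⟩)
  · exact (mem_pts_restartAt_of_ne hj hz).2 (Or.inr ⟨q, hq, rfl⟩)

theorem first_mem_pts (z : ℕ → ℝ × ℝ) : z 0 ∈ pts z := ⟨0, by simp [time]⟩

/-- Conditioning on the first update of source `i`. -/
theorem delivers_restartAt {i : Fin N} {e : ℝ × ℝ} {z z' : Config N} (he : 0 < e.1)
    (hz : Regular z) (hz' : Regular z') {w : ℝ} :
    Delivers (restartAt i e z z') i 0 w ↔ DeliversFrom i e.2 (w - e.1) z' := by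
  constructor
  · rintro ⟨p, hp, hc, h1, h2⟩
    rcases mem_pts_restartAt_self.1 hp with rfl | ⟨q, hq, rfl⟩
    · refine Or.inl ⟨by linarith, fun j => ?_⟩
      have h3 := hz'.time_pos j 0
      have := hc j _ (mem_pts_restartAt_of_mem hz (first_mem_pts (z' j))) (by simp only; linarith)
      simp only at this
      linarith
    · simp only at h2
      refine Or.inr ⟨q, hq, fun j q' hq' hlt => ?_, (hz'.pts_pos hq).1.le, by linarith⟩
      have := hc j _ (mem_pts_restartAt_of_mem hz hq') (by simp only; linarith)
      simp only at this
      linarith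
  · rintro (⟨h1, h2⟩ | ⟨p, hp, hc, h1, h2⟩)
    · refine ⟨e, mem_pts_restartAt_self.2 (Or.inl rfl), fun j q hq hlt => ?_, he.le, by linarith⟩
      obtain ⟨q', hq', rfl⟩ := exists_of_mem_pts_restartAt hz hq hlt
      have := pts_fst_ge (hz'.time_pos j) hq'
      have := h2 j
      simp only
      linarith
    · have hp0 := hz'.pts_pos hp
      refine ⟨_, mem_pts_restartAt_of_mem hz hp, fun j q hq hlt => ?_, by simp only; linarith,
        by simp only; linarith⟩
      simp only at hlt
      obtain ⟨q', hq', rfl⟩ := exists_of_mem_pts_restartAt hz hq (by linarith)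
      have := hc j q' hq' (by simp only at hlt; linarith)
      simp only
      linarith

/-- Conditioning on the next update of source `i`, for a system in which an update of source `i`
with service time `s` is in service. -/
theorem deliversFrom_restartAt {i : Fin N} {e : ℝ × ℝ} {z z' : Config N} (he : 0 < e.1)
    (hz : Regular z) (hz' : Regular z') {s v : ℝ} :
    DeliversFrom i s v (restartAt i e z z') ↔
      (s ≤ min v e.1 ∧ ∀ j, j ≠ i → s ≤ (z j 0).1) ∨ DeliversFrom i e.2 (v - e.1) z' := by
  rw [DeliversFrom, delivers_restartAt he hz hz']
  refine or_congr ?_ Iff.rfl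
  rw [le_min_iff, and_assoc]
  refine and_congr_right fun _ => ?_
  have hi : (restartAt i e z z' i 0).1 = e.1 := by simp [restartAt, cons]
  have hj : ∀ j, j ≠ i → s ≤ e.1 →
      (s ≤ (restartAt i e z z' j 0).1 ↔ s ≤ (z j 0).1) := by
    intro j hj hs
    have := hz'.time_pos j 0
    simp only [restartAt, if_neg hj, splice]
    split_ifs with h
    · exact iff_of_true (by simp only; linarith) (by linarith)
    · rfl
  constructor
  · intro h
    have h0 : s ≤ e.1 := hi ▸ h i
    exact ⟨h0, fun j hji => (hj j hji h0).1 (h j)⟩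
  · rintro ⟨h0, h⟩ j
    by_cases hji : j = i
    · subst hji; rw [hi]; exact h0
    · exact (hj j hji h0).2 (h j hji)

/-! ### The age in terms of deliveries -/

/-- Inter-arrival times as functions on configurations. -/
def interarrivalOf : Fin N → ℕ → Config N → ℝ := fun j k z => (z j k).1

/-- Service times as functions on configurations. -/
def serviceOf : Fin N → ℕ → Config N → ℝ := fun j k z => (z j k).2

theorem received_iff_completes {z : Config N} {i : Fin N} {k : ℕ} :
    Received interarrivalOf serviceOf i k z ↔ Completes z (time (z i) k, (z i k).2) := by
  constructor
  · rintro h j _ ⟨k', rfl⟩ hlt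
    exact h j k' hlt
  · intro h j k' hlt
    exact h j _ ⟨k', rfl⟩ hlt

theorem mem_receivedBy_iff {z : Config N} {i : Fin N} {t : ℝ} {k : ℕ} :
    k ∈ receivedBy interarrivalOf serviceOf i t z ↔
      Completes z (time (z i) k, (z i k).2) ∧ time (z i) k + (z i k).2 ≤ t :=
  and_congr received_iff_completes Iff.rfl

theorem bddAbove_receivedBy {z : Config N} (hz : Regular z) (i : Fin N) (t : ℝ) :
    BddAbove (receivedBy interarrivalOf serviceOf i t z) := by
  obtain ⟨n, hn⟩ := hz.unbounded i t
  refine ⟨n, fun k hk => ?_⟩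
  have h := (mem_receivedBy_iff.1 hk).2
  have := hz.mark_pos i k
  exact ((time_strictMono (hz.time_pos i)).lt_iff_lt.1 (by linarith : time (z i) k < _)).le

/-- The restriction `w < t` is needed: for `t ≤ w` the age is at most `w` even if nothing has been
received. -/
theorem age_le_iff {z : Config N} (hz : Regular z) (i : Fin N) {t w : ℝ} (htw : w < t) :
    age interarrivalOf serviceOf i t z ≤ w ↔ Delivers z i (t - w) t := by
  have hb := bddAbove_receivedBy hz i t
  rw [age, lastGenerated]
  split_ifs with hne
  · change t - time (z i) (sSup (receivedBy interarrivalOf serviceOf i t z)) ≤ w ↔ _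
    constructor
    · intro h
      obtain ⟨h1, h2⟩ := mem_receivedBy_iff.1 (Nat.sSup_mem hne hb)
      exact ⟨_, ⟨_, rfl⟩, h1, by simp only; linarith, h2⟩
    · rintro ⟨_, ⟨k, rfl⟩, h1, h2, h3⟩
      have := (time_strictMono (hz.time_pos i)).monotone
        (le_csSup hb (mem_receivedBy_iff.2 ⟨h1, h3⟩))
      simp only at h2
      linarith
  · refine iff_of_false (by linarith) ?_
    rintro ⟨_, ⟨k, rfl⟩, h1, h2, h3⟩
    exact hne ⟨k, mem_receivedBy_iff.2 ⟨h1, h3⟩⟩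

theorem age_pos {z : Config N} (hz : Regular z) (i : Fin N) {t : ℝ} (ht : 0 < t) :
    0 < age interarrivalOf serviceOf i t z := by
  refine not_le.1 fun h => ?_
  obtain ⟨p, hp, -, h1, h2⟩ := (age_le_iff hz i ht).1 h
  have := (hz.pts_pos hp).2
  linarith

/-! ### The law of the system -/

/-- The law of the marked arrival process of one source with rate `r`: independent exponential
inter-arrival times, with independent exponential service times as marks. -/
noncomputable def sourceLaw (r mu : ℝ) : Measure (ℕ → ℝ × ℝ) :=
  Measure.infinitePi fun _ => (expMeasure r).prod (expMeasure mu)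

/-- The law of the whole system: the sources are independent. -/
noncomputable def systemLaw (lam : Fin N → ℝ) (mu : ℝ) : Measure (Config N) :=
  Measure.pi fun j => sourceLaw (lam j) mu

theorem isProbabilityMeasure_sourceLaw {r mu : ℝ} (hr : 0 < r) (hmu : 0 < mu) :
    IsProbabilityMeasure (sourceLaw r mu) := by
  have := isProbabilityMeasure_expMeasure hr
  have := isProbabilityMeasure_expMeasure hmu
  unfold sourceLaw
  infer_instance

theorem isProbabilityMeasure_systemLaw {lam : Fin N → ℝ} (hlam : ∀ j, 0 < lam j) {mu : ℝ}
    (hmu : 0 < mu) : IsProbabilityMeasure (systemLaw lam mu) := by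
  have := fun j => isProbabilityMeasure_sourceLaw (hlam j) hmu
  unfold systemLaw
  infer_instance

theorem map_prod_coordinatewise (ν : Fin N → Measure (ℕ → ℝ × ℝ))
    [∀ j, IsProbabilityMeasure (ν j)]
    {T : Fin N → (ℕ → ℝ × ℝ) × (ℕ → ℝ × ℝ) → ℕ → ℝ × ℝ} (hT : ∀ j, Measurable (T j)) :
    ((Measure.pi ν).prod (Measure.pi ν)).map (fun p j => T j (p.1 j, p.2 j)) =
      Measure.pi fun j => ((ν j).prod (ν j)).map (T j) := by
  have : ∀ j, IsProbabilityMeasure (((ν j).prod (ν j)).map (T j)) :=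
    fun j => Measure.isProbabilityMeasure_map (hT j).aemeasurable
  rw [← Measure.pi_map_pi (fun j => (hT j).aemeasurable),
    ← (measurePreserving_arrowProdEquivProdArrow _ _ _ ν ν).map_eq,
    Measure.map_map (by fun_prop) (by fun_prop)]
  rfl

/-- The Markov property of the system at a fixed time `u`. -/
theorem measurePreserving_spliceAll {lam : Fin N → ℝ} (hlam : ∀ j, 0 < lam j) {mu : ℝ}
    (hmu : 0 < mu) {u : ℝ} (hu : 0 ≤ u) :
    MeasurePreserving (fun p : Config N × Config N => spliceAll u p.1 p.2)
      ((systemLaw lam mu).prod (systemLaw lam mu)) (systemLaw lam mu) := by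
  have := fun j => isProbabilityMeasure_sourceLaw (hlam j) hmu
  have := isProbabilityMeasure_expMeasure hmu
  refine ⟨measurable_pi_iff.2 fun j => (measurable_splice u).comp
    (f := fun p : Config N × Config N => (p.1 j, p.2 j)) (by fun_prop), ?_⟩
  refine (map_prod_coordinatewise (fun j => sourceLaw (lam j) mu)
    fun _ => measurable_splice u).trans ?_
  rw [systemLaw]
  congr 1
  funext j
  exact (measurePreserving_splice (hlam j) hu).map_eq

theorem measurable_restartAt (i : Fin N) :
    Measurable fun p : (ℝ × ℝ) × Config N × Config N => restartAt i p.1 p.2.1 p.2.2 := by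
  refine measurable_pi_iff.2 fun j => ?_
  by_cases hj : j = i
  · simp only [restartAt, if_pos hj]
    exact measurable_cons.comp (f := fun p : (ℝ × ℝ) × Config N × Config N => (p.1, p.2.2 i))
      (by fun_prop)
  · simp only [restartAt, if_neg hj]
    exact measurable_splice_uncurry.comp
      (f := fun p : (ℝ × ℝ) × Config N × Config N => (p.1.1, p.2.1 j, p.2.2 j)) (by fun_prop)

/-- The Markov property at the first arrival of source `i`. -/
theorem measurePreserving_restartAt {lam : Fin N → ℝ} (hlam : ∀ j, 0 < lam j) {mu : ℝ}
    (hmu : 0 < mu) (i : Fin N) :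
    MeasurePreserving (fun p : (ℝ × ℝ) × Config N × Config N => restartAt i p.1 p.2.1 p.2.2)
      (((expMeasure (lam i)).prod (expMeasure mu)).prod
        ((systemLaw lam mu).prod (systemLaw lam mu))) (systemLaw lam mu) := by
  have := fun j => isProbabilityMeasure_sourceLaw (hlam j) hmu
  have := fun j => isProbabilityMeasure_expMeasure (hlam j)
  have := isProbabilityMeasure_expMeasure hmu
  have := isProbabilityMeasure_systemLaw hlam hmu
  refine ⟨measurable_restartAt i, ?_⟩
  refine (Measure.pi_eq fun B hB => ?_).symm
  have hbox : MeasurableSet (Set.univ.pi B) := .univ_pi hB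
  rw [Measure.map_apply (measurable_restartAt i) hbox,
    Measure.prod_apply (hbox.preimage (measurable_restartAt i))]
  have hcons : ∀ e : ℝ × ℝ, Measurable fun y : ℕ → ℝ × ℝ => cons e y := fun e =>
    measurable_cons.comp (f := fun y : ℕ → ℝ × ℝ => (e, y)) (by fun_prop)
  have key : ∀ e : ℝ × ℝ, 0 < e.1 →
      ((systemLaw lam mu).prod (systemLaw lam mu)) (Prod.mk e ⁻¹'
        ((fun p : (ℝ × ℝ) × Config N × Config N => restartAt i p.1 p.2.1 p.2.2) ⁻¹'
          Set.univ.pi B)) =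
      sourceLaw (lam i) mu (Prod.mk e ⁻¹' ((fun p => cons p.1 p.2) ⁻¹' B i)) *
        ∏ j ∈ Finset.univ.erase i, sourceLaw (lam j) mu (B j) := by
    intro e he
    have hT : ∀ j, Measurable fun q : (ℕ → ℝ × ℝ) × (ℕ → ℝ × ℝ) =>
        if j = i then cons e q.2 else splice e.1 q.1 q.2 := by
      intro j
      by_cases hj : j = i
      · simp only [if_pos hj]
        exact (hcons e).comp measurable_snd
      · simp only [if_neg hj]
        exact measurable_splice e.1
    have hm := map_prod_coordinatewise (fun j => sourceLaw (lam j) mu) hT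
    have hm' : ∀ j, IsProbabilityMeasure (((sourceLaw (lam j) mu).prod (sourceLaw (lam j) mu)).map
        fun q => if j = i then cons e q.2 else splice e.1 q.1 q.2) :=
      fun j => Measure.isProbabilityMeasure_map (hT j).aemeasurable
    have h1 : (Prod.mk e ⁻¹'
        ((fun p : (ℝ × ℝ) × Config N × Config N => restartAt i p.1 p.2.1 p.2.2) ⁻¹'
          Set.univ.pi B)) = (fun (p : Config N × Config N) (j : Fin N) =>
            if j = i then cons e (p.2 j) else splice e.1 (p.1 j) (p.2 j)) ⁻¹' Set.univ.pi B := by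
      ext p
      simp only [Set.mem_preimage, Set.mem_univ_pi]
      refine forall_congr' fun j => ?_
      by_cases hj : j = i
      · subst hj; simp [restartAt]
      · simp [restartAt, hj]
    have hm0 : Measurable fun (p : Config N × Config N) (j : Fin N) =>
        if j = i then cons e (p.2 j) else splice e.1 (p.1 j) (p.2 j) :=
      measurable_pi_iff.2 fun j => (hT j).comp
        (f := fun p : Config N × Config N => (p.1 j, p.2 j)) (by fun_prop)
    rw [h1, ← Measure.map_apply hm0 hbox]
    have hm2 := congrArg (fun m : Measure (Config N) => m (Set.univ.pi B)) hm
    refine hm2.trans ?_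
    rw [Measure.pi_pi, ← Finset.mul_prod_erase _ _ (Finset.mem_univ i)]
    congr 1
    · rw [Measure.map_apply (hT i) (hB i)]
      have : (fun q : (ℕ → ℝ × ℝ) × (ℕ → ℝ × ℝ) => if i = i then cons e q.2 else
          splice e.1 q.1 q.2) ⁻¹' B i = Set.univ ×ˢ ((cons e) ⁻¹' B i) := by
        ext q; simp
      rw [this, Measure.prod_prod, measure_univ, one_mul]
      rfl
    · refine Finset.prod_congr rfl fun j hj => ?_
      have hji := Finset.ne_of_mem_erase hj
      simp only [if_neg hji]
      exact congrArg (fun m : Measure (ℕ → ℝ × ℝ) => m (B j))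
        (measurePreserving_splice (hlam j) he.le).map_eq
  have hpos : ∀ᵐ e ∂(expMeasure (lam i)).prod (expMeasure mu), 0 < e.1 :=
    (measurePreserving_fst (μ := expMeasure (lam i))
      (ν := expMeasure mu)).quasiMeasurePreserving.ae (expMeasure_ae_pos (hlam i))
  have hmB := (hB i).preimage (measurable_cons (α := ℝ × ℝ))
  rw [lintegral_congr_ae (hpos.mono key), lintegral_mul_const _
    (measurable_measure_prodMk_left hmB), ← Measure.prod_apply hmB,
    ← Finset.mul_prod_erase _ _ (Finset.mem_univ i)]
  congr 1
  exact (measurePreserving_cons ((expMeasure (lam i)).prod (expMeasure mu))).measure_preimage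
    (hB i).nullMeasurableSet

/-- Infinitely many inter-arrival times are at least `1`. -/
theorem ae_exists_one_le {r mu : ℝ} (hr : 0 < r) (hmu : 0 < mu) :
    ∀ᵐ z ∂sourceLaw r mu, ∀ m, ∃ k, m ≤ k ∧ 1 ≤ (z k).1 := by
  have := isProbabilityMeasure_expMeasure hr
  have := isProbabilityMeasure_expMeasure hmu
  rw [ae_all_iff]
  intro m
  set ρ := (expMeasure r).prod (expMeasure mu) with hρ
  have hA : MeasurableSet {e : ℝ × ℝ | e.1 < 1} := measurableSet_lt measurable_fst measurable_const
  have hc : ρ {e | e.1 < 1} < 1 := by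
    have h1 : {e : ℝ × ℝ | e.1 < 1} = (Set.Ici (1 : ℝ) ×ˢ Set.univ)ᶜ := by ext e; simp
    rw [h1, prob_compl_eq_one_sub (measurableSet_Ici.prod MeasurableSet.univ), hρ,
      Measure.prod_prod, measure_univ, mul_one, expMeasure_Ici hr zero_le_one]
    exact ENNReal.sub_lt_self ENNReal.one_ne_top one_ne_zero
      (by simpa using Real.exp_pos _)
  have hbound : ∀ n : ℕ, sourceLaw r mu {z | ¬ ∃ k, m ≤ k ∧ 1 ≤ (z k).1} ≤
      ρ {e | e.1 < 1} ^ n := by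
    intro n
    have h1 := infinitePi_initial ρ (m + n)
      (fun k => if m ≤ k then {e : ℝ × ℝ | e.1 < 1} else Set.univ)
      (fun k => by split_ifs; exacts [hA, MeasurableSet.univ])
    have h2 : ∏ k ∈ Finset.range (m + n), ρ (if m ≤ k then {e : ℝ × ℝ | e.1 < 1} else Set.univ) =
        ρ {e | e.1 < 1} ^ n := by
      rw [Finset.prod_range_add, Finset.prod_eq_one, one_mul]
      · simp
      · intro k hk
        rw [if_neg (by simpa using hk), measure_univ]
    rw [← h2, ← h1]
    refine measure_mono fun z hz k _ => ?_
    split_ifs with hk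
    · exact not_le.1 fun h => hz ⟨k, hk, h⟩
    · trivial
  exact le_antisymm (ge_of_tendsto' (ENNReal.tendsto_pow_atTop_nhds_zero_of_lt_one hc) hbound)
    (zero_le)

theorem exists_le_time {z : ℕ → ℝ × ℝ} (hz : ∀ k, 0 < (z k).1)
    (h : ∀ m, ∃ k, m ≤ k ∧ 1 ≤ (z k).1) (u : ℝ) : ∃ n, u ≤ time z n := by
  have hns : ¬ Summable fun k => (z k).1 := by
    intro hs
    obtain ⟨m, hm⟩ := eventually_atTop.1
      (hs.tendsto_atTop_zero.eventually (gt_mem_nhds zero_lt_one))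
    obtain ⟨k, hk, hk'⟩ := h m
    exact absurd (hm k hk) (not_lt.2 hk')
  have ht := (not_summable_iff_tendsto_nat_atTop_of_nonneg fun k => (hz k).le).1 hns
  obtain ⟨n, hn⟩ := ((tendsto_add_atTop_iff_nat 1).2 ht |>.eventually_ge_atTop u).exists
  exact ⟨n, hn⟩

theorem ae_regular {lam : Fin N → ℝ} (hlam : ∀ j, 0 < lam j) {mu : ℝ} (hmu : 0 < mu) :
    ∀ᵐ z ∂systemLaw lam mu, Regular z := by
  have := fun j => isProbabilityMeasure_sourceLaw (hlam j) hmu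
  have := fun j => isProbabilityMeasure_expMeasure (hlam j)
  have := isProbabilityMeasure_expMeasure hmu
  have hsource : ∀ j, ∀ᵐ z ∂sourceLaw (lam j) mu, (∀ k, 0 < (z k).1) ∧ (∀ k, 0 < (z k).2) ∧
      ∀ m, ∃ k, m ≤ k ∧ 1 ≤ (z k).1 := by
    intro j
    have he : ∀ k : ℕ, MeasurePreserving (fun z : ℕ → ℝ × ℝ => z k) (sourceLaw (lam j) mu)
        ((expMeasure (lam j)).prod (expMeasure mu)) := fun k =>
      measurePreserving_eval_infinitePi (fun _ : ℕ => (expMeasure (lam j)).prod (expMeasure mu)) k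
    have h1 : ∀ᵐ z ∂sourceLaw (lam j) mu, ∀ k, 0 < (z k).1 := ae_all_iff.2 fun k =>
      (measurePreserving_fst.comp (he k)).quasiMeasurePreserving.ae (expMeasure_ae_pos (hlam j))
    have h2 : ∀ᵐ z ∂sourceLaw (lam j) mu, ∀ k, 0 < (z k).2 := ae_all_iff.2 fun k =>
      (measurePreserving_snd.comp (he k)).quasiMeasurePreserving.ae (expMeasure_ae_pos hmu)
    filter_upwards [h1, h2, ae_exists_one_le (hlam j) hmu] with z h1 h2 h3 using ⟨h1, h2, h3⟩
  have hall : ∀ᵐ z ∂systemLaw lam mu, ∀ j, (∀ k, 0 < (z j k).1) ∧ (∀ k, 0 < (z j k).2) ∧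
      ∀ m, ∃ k, m ≤ k ∧ 1 ≤ (z j k).1 := ae_all_iff.2 fun j =>
    (measurePreserving_eval (fun j => sourceLaw (lam j) mu) j).quasiMeasurePreserving.ae
      (hsource j)
  filter_upwards [hall] with z hz
  exact ⟨fun j => (hz j).1, fun j => (hz j).2.1,
    fun j u => exists_le_time (hz j).1 (hz j).2.2 u⟩

/-! ### Measurability of the delivery events -/

theorem measurable_time (j : Fin N) (k : ℕ) : Measurable fun z : Config N => time (z j) k := by
  unfold time
  fun_prop

theorem measurableSet_delivers (i : Fin N) :
    MeasurableSet {p : ℝ × ℝ × Config N | Delivers p.2.2 i p.1 p.2.1} := by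
  have hset : {p : ℝ × ℝ × Config N | Delivers p.2.2 i p.1 p.2.1} =
      ⋃ k, ((⋂ j, ⋂ k', {p | time (p.2.2 i) k < time (p.2.2 j) k' →
        time (p.2.2 i) k + (p.2.2 i k).2 ≤ time (p.2.2 j) k'}) ∩
        ({p | p.1 ≤ time (p.2.2 i) k} ∩ {p | time (p.2.2 i) k + (p.2.2 i k).2 ≤ p.2.1})) := by
    ext p
    simp only [Set.mem_iUnion, Set.mem_inter_iff, Set.mem_iInter, Set.mem_ofPred_eq, Delivers,
      Completes, pts, Set.exists_range_iff, Set.forall_mem_range]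
  have ht : ∀ j k, Measurable fun p : ℝ × ℝ × Config N => time (p.2.2 j) k := fun j k =>
    (measurable_time j k).comp (by fun_prop)
  rw [hset]
  refine .iUnion fun k => .inter (.iInter fun j => .iInter fun k' => ?_) (.inter ?_ ?_)
  · have hs : MeasurableSet {p : ℝ × ℝ × Config N | time (p.2.2 i) k < time (p.2.2 j) k'} :=
      measurableSet_lt (ht i k) (ht j k')
    have hs' : MeasurableSet {p : ℝ × ℝ × Config N |
        time (p.2.2 i) k + (p.2.2 i k).2 ≤ time (p.2.2 j) k'} :=
      measurableSet_le ((ht i k).add (by fun_prop)) (ht j k')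
    exact hs.imp hs'
  · exact measurableSet_le measurable_fst (ht i k)
  · exact measurableSet_le ((ht i k).add (by fun_prop)) (by fun_prop)

theorem measurableSet_deliversFrom (i : Fin N) :
    MeasurableSet {p : ℝ × ℝ × Config N | DeliversFrom i p.1 p.2.1 p.2.2} := by
  refine MeasurableSet.union
    (.inter (measurableSet_le measurable_fst (measurable_fst.comp measurable_snd)) ?_) ?_
  · have h : MeasurableSet (⋂ j, {p : ℝ × ℝ × Config N | p.1 ≤ (p.2.2 j 0).1}) :=
      .iInter fun j => measurableSet_le measurable_fst (by fun_prop)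
    rw [← Set.ofPred_forall] at h
    exact h
  · exact (measurableSet_delivers i).preimage
      (f := fun p : ℝ × ℝ × Config N => ((0 : ℝ), p.2.1, p.2.2)) (by fun_prop)

/-! ### Transfer to the canonical space -/

/-- The configuration realised at `ω`. -/
def configOf {Ω : Type*} (X S : Fin N → ℕ → Ω → ℝ) (ω : Ω) : Config N :=
  fun j k => (X j k ω, S j k ω)

/-- Grouping the coordinates of a product measure in pairs. -/
theorem map_unpair_infinitePi {ι : Type*} (α β : ι → Measure ℝ)
    [∀ p, IsProbabilityMeasure (α p)] [∀ p, IsProbabilityMeasure (β p)] :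
    (Measure.infinitePi (Sum.elim α β)).map
      (fun (f : ι ⊕ ι → ℝ) p => (f (Sum.inl p), f (Sum.inr p))) =
      Measure.infinitePi fun p => (α p).prod (β p) := by
  classical
  have : ∀ s, IsProbabilityMeasure (Sum.elim α β s) := by
    rintro (p | p) <;> simp only [Sum.elim_inl, Sum.elim_inr] <;> infer_instance
  -- Measurable sets in `ℝ × ℝ` need not be rectangles, so a box of pairs need not be a box of
  -- coordinates. The converse holds, hence the law is computed for the inverse map.
  have hg : Measurable fun (y : ι → ℝ × ℝ) (s : ι ⊕ ι) =>
      Sum.elim (fun p => (y p).1) (fun p => (y p).2) s := by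
    refine measurable_pi_iff.2 ?_
    rintro (p | p) <;> simp only [Sum.elim_inl, Sum.elim_inr] <;> fun_prop
  have hsplit : (Measure.infinitePi fun p => (α p).prod (β p)).map
      (fun (y : ι → ℝ × ℝ) (s : ι ⊕ ι) => Sum.elim (fun p => (y p).1) (fun p => (y p).2) s) =
      Measure.infinitePi (Sum.elim α β) := by
    refine Measure.eq_infinitePi _ fun s t ht => ?_
    set T := s.toLeft ∪ s.toRight with hT
    set t' : ι ⊕ ι → Set ℝ := fun x => if x ∈ s then t x else Set.univ with ht'
    have hmt' : ∀ x, MeasurableSet (t' x) := fun x => by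
      simp only [ht']; split_ifs; exacts [ht x, MeasurableSet.univ]
    rw [Measure.map_apply hg (.pi s.countable_toSet fun x _ => ht x)]
    have hpre : (fun (y : ι → ℝ × ℝ) (s : ι ⊕ ι) =>
        Sum.elim (fun p => (y p).1) (fun p => (y p).2) s) ⁻¹' Set.pi s t =
        Set.pi T fun p => t' (Sum.inl p) ×ˢ t' (Sum.inr p) := by
      ext y
      simp only [Set.mem_preimage, Set.mem_pi, Finset.mem_coe, Set.mem_prod, hT, ht',
        Finset.mem_union, Finset.mem_toLeft, Finset.mem_toRight]
      constructor
      · intro hy p _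
        refine ⟨?_, ?_⟩ <;> split_ifs with hp
        · exact hy _ hp
        · trivial
        · exact hy _ hp
        · trivial
      · rintro hy (p | p) hp
        · simpa [hp] using (hy p (Or.inl hp)).1
        · simpa [hp] using (hy p (Or.inr hp)).2
    rw [hpre, Measure.infinitePi_pi _ fun p _ => (hmt' _).prod (hmt' _)]
    simp only [Measure.prod_prod]
    rw [Finset.prod_mul_distrib]
    have h1 : ∏ x ∈ T.disjSum T, Sum.elim α β x (t' x) =
        (∏ p ∈ T, α p (t' (Sum.inl p))) * ∏ p ∈ T, β p (t' (Sum.inr p)) := by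
      rw [Finset.prod_disjSum]; rfl
    have hsub : s ⊆ T.disjSum T := by
      rintro (p | p) hp
      · simp [hT, hp]
      · simp [hT, hp]
    rw [← h1, ← Finset.prod_subset hsub fun x _ hx => by simp [ht', hx]]
    exact Finset.prod_congr rfl fun x hx => by simp [ht', hx]
  rw [← hsplit, Measure.map_map (by fun_prop) hg]
  exact Measure.map_id

theorem IsMM11.map_configOf {Ω : Type*} [MeasurableSpace Ω] {P : Measure Ω}
    [IsProbabilityMeasure P] {lam : Fin N → ℝ} (hlam : ∀ j, 0 < lam j) {mu : ℝ} (hmu : 0 < mu)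
    {X S : Fin N → ℕ → Ω → ℝ} (h : IsMM11 P lam mu X S) :
    AEMeasurable (configOf X S) P ∧ P.map (configOf X S) = systemLaw lam mu := by
  have := fun j => isProbabilityMeasure_expMeasure (hlam j)
  have := isProbabilityMeasure_expMeasure hmu
  have := fun j => isProbabilityMeasure_sourceLaw (hlam j) hmu
  have hX : ∀ j k, AEMeasurable (X j k) P := fun j k => (h.law_interarrival j k).aemeasurable
  have hS : ∀ j k, AEMeasurable (S j k) P := fun j k => (h.law_service j k).aemeasurable
  have hae : AEMeasurable (configOf X S) P :=
    aemeasurable_pi_iff.2 fun j => aemeasurable_pi_iff.2 fun k => (hX j k).prodMk (hS j k)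
  refine ⟨hae, ?_⟩
  set V : (Fin N × ℕ) ⊕ (Fin N × ℕ) → Ω → ℝ := fun s =>
    Sum.elim (fun p => X p.1 p.2) (fun p => S p.1 p.2) s with hV
  have hVm : ∀ s, AEMeasurable (V s) P := by
    rintro (⟨j, k⟩ | ⟨j, k⟩)
    · exact hX j k
    · exact hS j k
  have hZm : AEMeasurable (fun ω (p : Fin N × ℕ) => (X p.1 p.2 ω, S p.1 p.2 ω)) P :=
    aemeasurable_pi_iff.2 fun p => (hX p.1 p.2).prodMk (hS p.1 p.2)
  have hlaw : P.map (fun ω (p : Fin N × ℕ) => (X p.1 p.2 ω, S p.1 p.2 ω)) =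
      Measure.infinitePi fun p : Fin N × ℕ => (expMeasure (lam p.1)).prod (expMeasure mu) := by
    have h1 := h.indep.map_fun_eq_infinitePi_map₀' hVm
    have h2 : (fun s => P.map (V s)) =
        Sum.elim (fun p : Fin N × ℕ => expMeasure (lam p.1)) fun _ => expMeasure mu := by
      funext s
      rcases s with ⟨j, k⟩ | ⟨j, k⟩
      · exact (h.law_interarrival j k).map_eq
      · exact (h.law_service j k).map_eq
    rw [← map_unpair_infinitePi, ← h2]
    have h3 := congrArg (Measure.map
      fun (f : (Fin N × ℕ) ⊕ (Fin N × ℕ) → ℝ) p => (f (Sum.inl p), f (Sum.inr p))) h1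
    rw [AEMeasurable.map_map_of_aemeasurable (by fun_prop) (aemeasurable_pi_iff.2 hVm)] at h3
    exact h3
  rw [systemLaw, ← Measure.infinitePi_eq_pi]
  have hcurry := Measure.infinitePi_map_curry fun (j : Fin N) (_ : ℕ) =>
    (expMeasure (lam j)).prod (expMeasure mu)
  rw [← hlaw, AEMeasurable.map_map_of_aemeasurable (by fun_prop)
    hZm] at hcurry
  exact hcurry

/-! ### Stationarity -/

/-- The probability that no update of source `i` is received during a time interval of
length `w` when the system starts empty. -/
noncomputable def silenceProb (lam : Fin N → ℝ) (mu : ℝ) (i : Fin N) (w : ℝ) : ℝ :=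
  (systemLaw lam mu).real {z | ¬ Delivers z i 0 w}

theorem measurableSet_delivers_window (i : Fin N) (c t : ℝ) :
    MeasurableSet {z : Config N | Delivers z i c t} :=
  (measurableSet_delivers i).preimage (f := fun z : Config N => (c, t, z)) (by fun_prop)

theorem ae_regular_prod {lam : Fin N → ℝ} (hlam : ∀ j, 0 < lam j) {mu : ℝ} (hmu : 0 < mu) :
    ∀ᵐ p ∂(systemLaw lam mu).prod (systemLaw lam mu), Regular p.1 ∧ Regular p.2 := by
  have := isProbabilityMeasure_systemLaw hlam hmu
  have h1 := (measurePreserving_fst (μ := systemLaw lam mu)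
    (ν := systemLaw lam mu)).quasiMeasurePreserving.ae (ae_regular hlam hmu)
  have h2 := (measurePreserving_snd (μ := systemLaw lam mu)
    (ν := systemLaw lam mu)).quasiMeasurePreserving.ae (ae_regular hlam hmu)
  filter_upwards [h1, h2] with p h1 h2 using ⟨h1, h2⟩

/-- The probability that nothing is delivered during a window depends only on its length, by the
Markov property at its left end. -/
theorem measureReal_not_delivers_window {lam : Fin N → ℝ} (hlam : ∀ j, 0 < lam j) {mu : ℝ}
    (hmu : 0 < mu) (i : Fin N) {u : ℝ} (hu : 0 ≤ u) (w : ℝ) :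
    (systemLaw lam mu).real {z | ¬ Delivers z i u (u + w)} = silenceProb lam mu i w := by
  have := isProbabilityMeasure_systemLaw hlam hmu
  have h1 : MeasurableSet {z : Config N | ¬ Delivers z i u (u + w)} :=
    (measurableSet_delivers_window i _ _).compl
  have h2 : MeasurableSet {z : Config N | ¬ Delivers z i 0 w} :=
    (measurableSet_delivers_window i _ _).compl
  rw [silenceProb, measureReal_def, measureReal_def,
    ← (measurePreserving_spliceAll hlam hmu hu).measure_preimage h1.nullMeasurableSet,
    ← (measurePreserving_snd (μ := systemLaw lam mu)
      (ν := systemLaw lam mu)).measure_preimage h2.nullMeasurableSet]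
  congr 1
  refine measure_congr ?_
  filter_upwards [ae_regular_prod hlam hmu] with p hp
  refine propext (not_congr ?_)
  have := delivers_spliceAll_add (i := i) (u := u) (a := 0) (b := w) hp.1 hp.2 le_rfl
  rwa [add_zero] at this

/-! ### The law of large numbers -/

/-- The amount of time `t` in the block `[c, c + w)` such that no update of source `i` that
arrived during `[t - w, t]` has been received by `t`. -/
noncomputable def silentTime (i : Fin N) (w c : ℝ) (z : Config N) : ℝ :=
  volume.real ({t | ¬ Delivers z i (t - w) t} ∩ Set.Ico c (c + w))

theorem measurableSet_silent_prod (i : Fin N) (w c : ℝ) :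
    MeasurableSet {p : Config N × ℝ |
      p.2 ∈ {t | ¬ Delivers p.1 i (t - w) t} ∩ Set.Ico c (c + w)} := by
  refine MeasurableSet.inter ?_ (measurableSet_Ico.preimage measurable_snd)
  exact ((measurableSet_delivers i).preimage
    (f := fun p : Config N × ℝ => (p.2 - w, p.2, p.1)) (by fun_prop)).compl

theorem measurableSet_silent (i : Fin N) (w : ℝ) (z : Config N) :
    MeasurableSet {t : ℝ | ¬ Delivers z i (t - w) t} :=
  ((measurableSet_delivers i).preimage (f := fun t : ℝ => (t - w, t, z)) (by fun_prop)).compl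

theorem measurable_silentTime (i : Fin N) (w c : ℝ) : Measurable (silentTime i w c) :=
  (measurable_measure_prodMk_left (ν := (volume : Measure ℝ))
    (measurableSet_silent_prod i w c)).ennreal_toReal

theorem silentTime_nonneg (i : Fin N) (w c : ℝ) (z : Config N) : 0 ≤ silentTime i w c z :=
  measureReal_nonneg

theorem silentTime_le (i : Fin N) {w : ℝ} (hw : 0 ≤ w) (c : ℝ) (z : Config N) :
    silentTime i w c z ≤ w := by
  refine (measureReal_mono Set.inter_subset_right (by simp)).trans ?_
  rw [Real.volume_real_Ico_of_le (by linarith)]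
  linarith

theorem silentTime_spliceAll_self (i : Fin N) {w u : ℝ} {z z' : Config N}
    (hz : Regular z) (hz' : Regular z') :
    silentTime i w (u + w) (spliceAll u z z') = silentTime i w w z' := by
  rw [silentTime, silentTime, measureReal_def, measureReal_def]
  congr 1
  rw [← measure_preimage_add volume u]
  congr 1
  ext t
  have key : 0 ≤ t - w → (Delivers (spliceAll u z z') i (u + t - w) (u + t) ↔
      Delivers z' i (t - w) t) := fun h => by
    rw [add_sub_assoc]; exact delivers_spliceAll_add hz hz' h
  simp only [Set.mem_preimage, Set.mem_inter_iff, Set.mem_ofPred_eq, Set.mem_Ico]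
  constructor
  · rintro ⟨h1, h2, h3⟩
    exact ⟨fun h => h1 ((key (by linarith)).2 h), by linarith, by linarith⟩
  · rintro ⟨h1, h2, h3⟩
    exact ⟨fun h => h1 ((key (by linarith)).1 h), by linarith, by linarith⟩

theorem silentTime_spliceAll_of_le (i : Fin N) {w u c : ℝ} (hc : c + w ≤ u) {z z' : Config N}
    (hz : Regular z) (hz' : Regular z') :
    silentTime i w c (spliceAll u z z') = silentTime i w c z := by
  rw [silentTime, silentTime]
  congr 1
  ext t
  have key : t ≤ u → (Delivers (spliceAll u z z') i (t - w) t ↔ Delivers z i (t - w) t) :=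
    fun h => delivers_spliceAll_of_le hz hz' h
  simp only [Set.mem_inter_iff, Set.mem_ofPred_eq, Set.mem_Ico]
  exact and_congr_left fun h => not_congr (key (by linarith))

section LLN

variable {lam : Fin N → ℝ} {mu : ℝ}

/-- All blocks that start at `w` or later are identically distributed. -/
theorem map_silentTime (hlam : ∀ j, 0 < lam j) (hmu : 0 < mu) (i : Fin N) {w c : ℝ}
    (hc : w ≤ c) :
    (systemLaw lam mu).map (silentTime i w c) = (systemLaw lam mu).map (silentTime i w w) := by
  have := isProbabilityMeasure_systemLaw hlam hmu
  have hsp := measurePreserving_spliceAll hlam hmu (sub_nonneg.2 hc)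
  conv_lhs => rw [← hsp.map_eq, Measure.map_map (measurable_silentTime i w c) hsp.measurable]
  conv_rhs => rw [← (measurePreserving_snd (μ := systemLaw lam mu)
    (ν := systemLaw lam mu)).map_eq, Measure.map_map (measurable_silentTime i w w) measurable_snd]
  refine Measure.map_congr ?_
  filter_upwards [ae_regular_prod hlam hmu] with p hp
  have := silentTime_spliceAll_self i (w := w) (u := c - w) hp.1 hp.2
  rwa [sub_add_cancel] at this

/-- Blocks at a distance of at least `w` are independent. -/
theorem indepFun_silentTime (hlam : ∀ j, 0 < lam j) (hmu : 0 < mu) (i : Fin N) {w c c' : ℝ}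
    (hw : 0 ≤ w) (hc : w ≤ c) (hc' : c + w ≤ c' - w) :
    IndepFun (silentTime i w c) (silentTime i w c') (systemLaw lam mu) := by
  have := isProbabilityMeasure_systemLaw hlam hmu
  have hm := measurable_silentTime i w (N := N)
  rw [indepFun_iff_map_prod_eq_prod_map_map (hm c).aemeasurable (hm c').aemeasurable,
    map_silentTime hlam hmu i (by linarith : w ≤ c'),
    Measure.map_prod_map _ _ (hm c) (hm w)]
  have hsp := measurePreserving_spliceAll hlam hmu (by linarith : 0 ≤ c' - w)
  conv_lhs => rw [← hsp.map_eq, Measure.map_map ((hm c).prodMk (hm c')) hsp.measurable]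
  refine Measure.map_congr ?_
  filter_upwards [ae_regular_prod hlam hmu] with p hp
  have h1 := silentTime_spliceAll_self i (w := w) (u := c' - w) hp.1 hp.2
  rw [sub_add_cancel] at h1
  exact Prod.ext (silentTime_spliceAll_of_le i hc' hp.1 hp.2) h1

theorem integral_silentTime (hlam : ∀ j, 0 < lam j) (hmu : 0 < mu) (i : Fin N) {w c : ℝ}
    (hw : 0 ≤ w) (hc : w ≤ c) :
    ∫ z, silentTime i w c z ∂systemLaw lam mu = w * silenceProb lam mu i w := by
  have := isProbabilityMeasure_systemLaw hlam hmu
  have hS := measurableSet_silent_prod i w c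
  have h1 : ∫ z, silentTime i w c z ∂systemLaw lam mu =
      (((systemLaw lam mu).prod volume) {p : Config N × ℝ |
        p.2 ∈ {t | ¬ Delivers p.1 i (t - w) t} ∩ Set.Ico c (c + w)}).toReal := by
    rw [Measure.prod_apply hS]
    refine integral_toReal (measurable_measure_prodMk_left hS).aemeasurable ?_
    refine Eventually.of_forall fun z => ?_
    exact (measure_mono (Set.inter_subset_right)).trans_lt (measure_Ico_lt_top (a := c) (b := c + w))
  have h2 : ((systemLaw lam mu).prod volume) {p : Config N × ℝ |
        p.2 ∈ {t | ¬ Delivers p.1 i (t - w) t} ∩ Set.Ico c (c + w)} =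
      ∫⁻ t, (Set.Ico c (c + w)).indicator
        (fun _ => ENNReal.ofReal (silenceProb lam mu i w)) t := by
    rw [Measure.prod_apply_symm hS]
    refine lintegral_congr fun t => ?_
    by_cases ht : t ∈ Set.Ico c (c + w)
    · rw [Set.indicator_of_mem ht,
        ← measureReal_not_delivers_window hlam hmu i (u := t - w) (by linarith [ht.1]) w,
        ofReal_measureReal]
      congr 1
      ext z
      simp only [Set.mem_preimage, Set.mem_ofPred_eq, Set.mem_inter_iff, ht, and_true,
        sub_add_cancel]
    · rw [Set.indicator_of_notMem ht]
      refine measure_mono_null (fun z hz => ht hz.2) measure_empty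
  rw [h1, h2, lintegral_indicator_const measurableSet_Ico, Real.volume_Ico, add_sub_cancel_left,
    ENNReal.toReal_mul, ENNReal.toReal_ofReal (by exact measureReal_nonneg), ENNReal.toReal_ofReal hw,
    mul_comm]

/-- The strong law of large numbers for every other block. -/
theorem ae_tendsto_silentTime (hlam : ∀ j, 0 < lam j) (hmu : 0 < mu) (i : Fin N) {w c : ℝ}
    (hw : 0 ≤ w) (hc : w ≤ c) :
    ∀ᵐ z ∂systemLaw lam mu, Tendsto (fun n : ℕ =>
      (∑ k ∈ Finset.range n, silentTime i w (c + k * (2 * w)) z) / n) atTop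
        (𝓝 (w * silenceProb lam mu i w)) := by
  have := isProbabilityMeasure_systemLaw hlam hmu
  have hck : ∀ k : ℕ, w ≤ c + k * (2 * w) := fun k => by
    have : (0 : ℝ) ≤ k * (2 * w) := by positivity
    linarith
  have hstep : ∀ k l : ℕ, k < l → c + k * (2 * w) + w ≤ c + l * (2 * w) - w := by
    intro k l hkl
    have h1 : (k : ℝ) + 1 ≤ l := by exact_mod_cast hkl
    nlinarith
  have hind : ∀ k l : ℕ, k < l → IndepFun (silentTime i w (c + k * (2 * w)))
      (silentTime i w (c + l * (2 * w))) (systemLaw lam mu) := fun k l hkl =>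
    indepFun_silentTime hlam hmu i hw (hck k) (hstep k l hkl)
  have h := strong_law_ae_real (μ := systemLaw lam mu)
    (fun k : ℕ => silentTime i w (c + k * (2 * w))) ?_ ?_ ?_
  · rwa [integral_silentTime hlam hmu i hw (hck 0)] at h
  · refine Integrable.of_bound (measurable_silentTime i w _).aestronglyMeasurable w
      (Eventually.of_forall fun z => ?_)
    rw [Real.norm_of_nonneg (silentTime_nonneg i w _ z)]
    exact silentTime_le i hw _ z
  · intro k l hkl
    rcases lt_or_gt_of_ne hkl with h | h
    · exact hind k l h
    · exact (hind l k h).symm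
  · exact fun k => ⟨(measurable_silentTime i w _).aemeasurable,
      (measurable_silentTime i w _).aemeasurable,
      (map_silentTime hlam hmu i (hck k)).trans (map_silentTime hlam hmu i (hck 0)).symm⟩

end LLN

theorem measureReal_inter_Ico_add {A : Set ℝ} {a b c : ℝ} (hab : a ≤ b)
    (hbc : b ≤ c) :
    volume.real (A ∩ Set.Ico a b) + volume.real (A ∩ Set.Ico b c) =
      volume.real (A ∩ Set.Ico a c) := by
  have hfin : volume (A ∩ Set.Ico a c) ≠ ⊤ :=
    ((measure_mono Set.inter_subset_right).trans_lt measure_Ico_lt_top).ne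
  rw [← measureReal_inter_add_sdiff (s := A ∩ Set.Ico a c) (measurableSet_Iio (a := b)) hfin]
  congr 2
  · ext t
    simp only [Set.mem_inter_iff, Set.mem_Ico, Set.mem_Iio]
    constructor
    · rintro ⟨h1, h2, h3⟩; exact ⟨⟨h1, h2, by linarith⟩, h3⟩
    · rintro ⟨⟨h1, h2, -⟩, h3⟩; exact ⟨h1, h2, h3⟩
  · ext t
    simp only [Set.mem_inter_iff, Set.mem_Ico, Set.mem_Iio, Set.mem_sdiff, not_lt]
    constructor
    · rintro ⟨h1, h2, h3⟩; exact ⟨⟨h1, by linarith, h3⟩, h2⟩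
    · rintro ⟨⟨h1, -, h3⟩, h2⟩; exact ⟨h1, h2, h3⟩

theorem measureReal_inter_Ico_blocks (A : Set ℝ) {a M : ℝ} (hM : 0 ≤ M) (n : ℕ) :
    volume.real (A ∩ Set.Ico a (a + n * M)) =
      ∑ k ∈ Finset.range n, volume.real (A ∩ Set.Ico (a + k * M) (a + k * M + M)) := by
  induction n with
  | zero => simp
  | succ n ih =>
    have h0 : (0 : ℝ) ≤ n * M := by positivity
    rw [Finset.sum_range_succ, ← ih, measureReal_inter_Ico_add (by linarith) (by linarith)]
    push_cast
    ring_nf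

/-- A convergence along blocks of length `M` that start at `w` gives the convergence of the
fraction of time, even for a set `B` that agrees with `A` only after `w`. -/
theorem tendsto_fraction_of_blocks {A B : Set ℝ} {w M p : ℝ} (hw : 0 ≤ w) (hM : 0 < M)
    (hAB : ∀ t, w < t → (t ∈ B ↔ t ∈ A))
    (h : Tendsto (fun n : ℕ => volume.real (A ∩ Set.Ico w (w + n * M)) / n) atTop (𝓝 (M * p))) :
    Tendsto (fun T : ℝ => volume.real {t : ℝ | 0 ≤ t ∧ t ≤ T ∧ t ∈ B} / T) atTop (𝓝 p) := by
  set J : ℕ → ℝ := fun n => volume.real (A ∩ Set.Ico w (w + n * M)) with hJ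
  have hfloor : Tendsto (fun T : ℝ => ⌊M⁻¹ * T⌋₊) atTop atTop :=
    tendsto_nat_floor_atTop.comp (tendsto_id.const_mul_atTop (inv_pos.2 hM))
  have h1 : Tendsto (fun T : ℝ => J ⌊M⁻¹ * T⌋₊ / T) atTop (𝓝 p) := by
    have h2 := (h.comp hfloor).mul
      (tendsto_nat_floor_mul_div_atTop (R := ℝ) (inv_pos.2 hM).le)
    rw [show M * p * M⁻¹ = p by field_simp] at h2
    refine h2.congr' ?_
    filter_upwards [hfloor.eventually_gt_atTop 0] with T hT
    have : (0 : ℝ) < ⌊M⁻¹ * T⌋₊ := by exact_mod_cast hT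
    rw [Function.comp_apply, div_mul_div_cancel₀ this.ne']
  have hconst : ∀ C : ℝ, Tendsto (fun T : ℝ => C / T) atTop (𝓝 0) := fun C =>
    tendsto_const_nhds.div_atTop tendsto_id
  have hlow : Tendsto (fun T : ℝ => J ⌊M⁻¹ * T⌋₊ / T - w / T) atTop (𝓝 p) := by
    simpa using h1.sub (hconst w)
  have hupp : Tendsto (fun T : ℝ => J ⌊M⁻¹ * T⌋₊ / T + (w + M) / T) atTop (𝓝 p) := by
    simpa using h1.add (hconst (w + M))
  refine tendsto_of_tendsto_of_tendsto_of_le_of_le' hlow hupp ?_ ?_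
  · filter_upwards [eventually_gt_atTop 0] with T hT
    rw [← sub_div]
    refine div_le_div_of_nonneg_right ?_ hT.le
    have hn : (⌊M⁻¹ * T⌋₊ : ℝ) * M ≤ T := by
      have := Nat.floor_le (show 0 ≤ M⁻¹ * T by positivity)
      calc (⌊M⁻¹ * T⌋₊ : ℝ) * M ≤ M⁻¹ * T * M := by gcongr
        _ = T := by field_simp
    have hsub : A ∩ Set.Ico w (w + ⌊M⁻¹ * T⌋₊ * M) ⊆
        {t : ℝ | 0 ≤ t ∧ t ≤ T ∧ t ∈ B} ∪ ({w} ∪ Set.Icc T (T + w)) := by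
      rintro t ⟨htA, ht1, ht2⟩
      rcases ht1.eq_or_lt with rfl | ht1
      · exact Or.inr (Or.inl rfl)
      · rcases le_or_gt t T with htT | htT
        · exact Or.inl ⟨by linarith, htT, (hAB t ht1).2 htA⟩
        · exact Or.inr (Or.inr ⟨htT.le, by linarith⟩)
    have hfin : volume ({t : ℝ | 0 ≤ t ∧ t ≤ T ∧ t ∈ B} ∪ ({w} ∪ Set.Icc T (T + w))) ≠ ⊤ := by
      refine ((measure_mono (Set.union_subset_union_left _
        (fun t ht => ⟨ht.1, ht.2.1⟩ : {t : ℝ | 0 ≤ t ∧ t ≤ T ∧ t ∈ B} ⊆ Set.Icc 0 T))).trans_lt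
          ?_).ne
      exact measure_union_lt_top measure_Icc_lt_top
        (measure_union_lt_top (by simp) measure_Icc_lt_top)
    have h3 := (measureReal_mono hsub hfin).trans (measureReal_union_le _ _)
    have h4 := measureReal_union_le (μ := volume) {w} (Set.Icc T (T + w))
    rw [Real.volume_real_Icc_of_le (by linarith)] at h4
    simp only [measureReal_def, Real.volume_singleton, ENNReal.toReal_zero] at h3 h4 ⊢
    simp only [hJ, measureReal_def]
    linarith
  · filter_upwards [eventually_gt_atTop 0] with T hT
    rw [← add_div]
    refine div_le_div_of_nonneg_right ?_ hT.le
    have hn : T ≤ (⌊M⁻¹ * T⌋₊ : ℝ) * M + M := by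
      have := (Nat.lt_floor_add_one (M⁻¹ * T)).le
      calc T = M⁻¹ * T * M := by field_simp
        _ ≤ (⌊M⁻¹ * T⌋₊ + 1) * M := by gcongr
        _ = _ := by ring
    set L := w + ⌊M⁻¹ * T⌋₊ * M with hL
    have hsub : {t : ℝ | 0 ≤ t ∧ t ≤ T ∧ t ∈ B} ⊆
        (A ∩ Set.Ico w L) ∪ (Set.Icc 0 w ∪ Set.Icc L (L + M)) := by
      rintro t ⟨ht0, htT, htB⟩
      rcases le_or_gt t w with htw | htw
      · exact Or.inr (Or.inl ⟨ht0, htw⟩)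
      · rcases lt_or_ge t L with htL | htL
        · exact Or.inl ⟨(hAB t htw).1 htB, htw.le, htL⟩
        · exact Or.inr (Or.inr ⟨htL, by linarith⟩)
    have hfin : volume ((A ∩ Set.Ico w L) ∪ (Set.Icc 0 w ∪ Set.Icc L (L + M))) ≠ ⊤ :=
      (measure_union_lt_top
        ((measure_mono Set.inter_subset_right).trans_lt measure_Ico_lt_top)
        (measure_union_lt_top measure_Icc_lt_top measure_Icc_lt_top)).ne
    have h3 := (measureReal_mono hsub hfin).trans (measureReal_union_le _ _)
    have h4 := measureReal_union_le (μ := volume) (Set.Icc 0 w) (Set.Icc L (L + M))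
    rw [Real.volume_real_Icc_of_le hw, Real.volume_real_Icc_of_le (by linarith)] at h4
    simp only [hJ]
    linarith

theorem ae_tendsto_blocks {lam : Fin N → ℝ} {mu : ℝ} (hlam : ∀ j, 0 < lam j) (hmu : 0 < mu)
    (i : Fin N) {w : ℝ} (hw : 0 < w) :
    ∀ᵐ z ∂systemLaw lam mu, Tendsto (fun n : ℕ =>
      volume.real ({t | ¬ Delivers z i (t - w) t} ∩ Set.Ico w (w + n * (2 * w))) / n) atTop
        (𝓝 (2 * w * silenceProb lam mu i w)) := by
  -- The blocks that start at `w + 2 k w` and those that start at `2 w + 2 k w` are treated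
  -- separately, since adjacent blocks are not independent.
  filter_upwards [ae_tendsto_silentTime hlam hmu i hw.le le_rfl,
    ae_tendsto_silentTime hlam hmu i hw.le (by linarith : w ≤ 2 * w)] with z h1 h2
  have h := h1.add h2
  rw [show w * silenceProb lam mu i w + w * silenceProb lam mu i w =
    2 * w * silenceProb lam mu i w by ring] at h
  refine h.congr fun n => ?_
  rw [measureReal_inter_Ico_blocks _ (by linarith : 0 ≤ 2 * w), ← add_div,
    ← Finset.sum_add_distrib]
  congr 1
  refine Finset.sum_congr rfl fun k _ => ?_
  rw [← measureReal_inter_Ico_add (b := w + k * (2 * w) + w) (by linarith) (by linarith),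
    silentTime, silentTime]
  congr 4 <;> ring

/-! ### Long-run probabilities -/

section LongRun

variable {Ω : Type*} [MeasurableSpace Ω] {P : Measure Ω} [IsProbabilityMeasure P]
  {lam : Fin N → ℝ} {mu : ℝ} {X S : Fin N → ℕ → Ω → ℝ}

theorem IsMM11.ae_regular (hsys : IsMM11 P lam mu X S) (hlam : ∀ j, 0 < lam j) (hmu : 0 < mu) :
    ∀ᵐ ω ∂P, Regular (configOf X S ω) := by
  obtain ⟨hm, hmap⟩ := hsys.map_configOf hlam hmu
  exact ae_of_ae_map hm (hmap ▸ AoI.ae_regular hlam hmu)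

theorem IsMM11.measureReal_age_gt (hsys : IsMM11 P lam mu X S) (hlam : ∀ j, 0 < lam j)
    (hmu : 0 < mu) (i : Fin N) {w t : ℝ} (ht : w < t) :
    P.real {ω | age X S i t ω ∈ Set.Ioi w} = silenceProb lam mu i w := by
  obtain ⟨hm, hmap⟩ := hsys.map_configOf hlam hmu
  have hS : MeasurableSet {z : Config N | ¬ Delivers z i (t - w) t} :=
    (measurableSet_delivers_window i _ _).compl
  have h1 := measureReal_not_delivers_window hlam hmu i (sub_nonneg.2 ht.le) w
  rw [sub_add_cancel, measureReal_def, ← hmap, Measure.map_apply_of_aemeasurable hm hS] at h1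
  rw [← h1, measureReal_def]
  congr 1
  refine measure_congr ?_
  filter_upwards [hsys.ae_regular hlam hmu] with ω hω
  exact propext (not_le.symm.trans (not_congr (age_le_iff hω i ht)))

theorem IsMM11.measureReal_age_le (hsys : IsMM11 P lam mu X S) (hlam : ∀ j, 0 < lam j)
    (hmu : 0 < mu) (i : Fin N) {w t : ℝ} (ht : w < t) :
    P.real {ω | age X S i t ω ∈ Set.Iic w} = 1 - silenceProb lam mu i w := by
  obtain ⟨hm, hmap⟩ := hsys.map_configOf hlam hmu
  have hS : MeasurableSet {z : Config N | Delivers z i (t - w) t} :=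
    measurableSet_delivers_window i _ _
  have := isProbabilityMeasure_systemLaw hlam hmu
  have h1 := measureReal_not_delivers_window hlam hmu i (sub_nonneg.2 ht.le) w
  have h2 : {z : Config N | ¬ Delivers z i (t - w) t} = {z | Delivers z i (t - w) t}ᶜ := rfl
  rw [sub_add_cancel, h2, probReal_compl_eq_one_sub hS, sub_eq_iff_eq_add, ← sub_eq_iff_eq_add',
    measureReal_def, ← hmap, Measure.map_apply_of_aemeasurable hm hS] at h1
  rw [h1, measureReal_def]
  congr 1
  refine measure_congr ?_
  filter_upwards [hsys.ae_regular hlam hmu] with ω hω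
  exact propext (age_le_iff hω i ht)

theorem IsMM11.isLongRunProb_age_gt (hsys : IsMM11 P lam mu X S) (hlam : ∀ j, 0 < lam j)
    (hmu : 0 < mu) (i : Fin N) {w : ℝ} (hw : 0 < w) :
    IsLongRunProb P (age X S i) (Set.Ioi w) (silenceProb lam mu i w) := by
  obtain ⟨hm, hmap⟩ := hsys.map_configOf hlam hmu
  refine ⟨tendsto_const_nhds.congr' ?_, ?_⟩
  · filter_upwards [eventually_gt_atTop w] with t ht
    exact (hsys.measureReal_age_gt hlam hmu i ht).symm
  · filter_upwards [hsys.ae_regular hlam hmu,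
      ae_of_ae_map hm (hmap ▸ ae_tendsto_blocks hlam hmu i hw)] with ω hω hlim
    refine tendsto_fraction_of_blocks (B := {t | age X S i t ω ∈ Set.Ioi w}) hw.le
      (by linarith : 0 < 2 * w) (fun t ht => ?_) hlim
    exact not_le.symm.trans (not_congr (age_le_iff hω i ht))

theorem IsMM11.isLongRunProb_age_le (hsys : IsMM11 P lam mu X S) (hlam : ∀ j, 0 < lam j)
    (hmu : 0 < mu) (i : Fin N) {w : ℝ} (hw : 0 < w) :
    IsLongRunProb P (age X S i) (Set.Iic w) (1 - silenceProb lam mu i w) := by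
  obtain ⟨hm, hmap⟩ := hsys.map_configOf hlam hmu
  refine ⟨tendsto_const_nhds.congr' ?_, ?_⟩
  · filter_upwards [eventually_gt_atTop w] with t ht
    exact (hsys.measureReal_age_le hlam hmu i ht).symm
  · filter_upwards [hsys.ae_regular hlam hmu,
      ae_of_ae_map hm (hmap ▸ ae_tendsto_blocks hlam hmu i hw)] with ω hω hlim
    refine tendsto_fraction_of_blocks (B := {t | age X S i t ω ∈ Set.Iic w})
      (A := {t | Delivers (configOf X S ω) i (t - w) t}) hw.le
      (by linarith : 0 < 2 * w) (fun t ht => age_le_iff hω i ht) ?_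
    have h1 := hlim.const_sub (2 * w)
    rw [show 2 * w - 2 * w * silenceProb lam mu i w = 2 * w * (1 - silenceProb lam mu i w) by
      ring] at h1
    refine h1.congr' ?_
    filter_upwards [eventually_gt_atTop 0] with n hn
    have hn' : (0 : ℝ) < n := by exact_mod_cast hn
    have h2 := measureReal_inter_add_sdiff (μ := volume) (s := Set.Ico w (w + n * (2 * w)))
      (measurableSet_silent i w (configOf X S ω)) measure_Ico_lt_top.ne
    have h3 : Set.Ico w (w + n * (2 * w)) \ {t | ¬ Delivers (configOf X S ω) i (t - w) t} =
        {t | Delivers (configOf X S ω) i (t - w) t} ∩ Set.Ico w (w + n * (2 * w)) := by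
      ext t
      simp only [Set.mem_sdiff, Set.mem_inter_iff, Set.mem_ofPred_eq, not_not, and_comm]
    have h4 : (0 : ℝ) ≤ n * (2 * w) := by positivity
    rw [h3, Set.inter_comm, Real.volume_real_Ico_of_le (by linarith), add_sub_cancel_left] at h2
    rw [eq_div_iff hn'.ne', sub_mul, div_mul_cancel₀ _ hn'.ne']
    linarith

theorem IsMM11.isLongRunProb_age_le_of_nonpos (hsys : IsMM11 P lam mu X S)
    (hlam : ∀ j, 0 < lam j) (hmu : 0 < mu) (i : Fin N) {w : ℝ} (hw : w ≤ 0) :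
    IsLongRunProb P (age X S i) (Set.Iic w) 0 := by
  refine ⟨tendsto_const_nhds.congr' ?_, ?_⟩
  · filter_upwards [eventually_gt_atTop 0] with t ht
    rw [measureReal_def, eq_comm, ENNReal.toReal_eq_zero_iff]
    refine Or.inl (measure_mono_null ?_ (hsys.ae_regular hlam hmu))
    intro ω hω hreg
    have := age_pos hreg i ht
    have h' : age X S i t ω ≤ w := hω
    exact absurd (lt_of_lt_of_le this h') (not_lt.2 hw)
  · filter_upwards [hsys.ae_regular hlam hmu] with ω hω
    refine tendsto_const_nhds.congr fun T => ?_
    have h : volume.real {t : ℝ | 0 ≤ t ∧ t ≤ T ∧ age X S i t ω ∈ Set.Iic w} = 0 := by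
      rw [measureReal_def, ENNReal.toReal_eq_zero_iff]
      refine Or.inl (measure_mono_null (fun t ht => ?_) (Real.volume_singleton (a := 0)))
      by_contra h0
      have := age_pos hω i (lt_of_le_of_ne ht.1 (Ne.symm h0))
      have h' : age X S i t ω ≤ w := ht.2.2
      exact absurd (lt_of_lt_of_le this h') (not_lt.2 hw)
    rw [h, zero_div]

end LongRun

/-! ### Renewal equations -/

/-- The probability that no update of source `i` is received by time `v`, when an update of
source `i` enters service at time `0`. -/
noncomputable def busySilence (lam : Fin N → ℝ) (mu : ℝ) (i : Fin N) (v : ℝ) : ENNReal :=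
  ((expMeasure mu).prod (systemLaw lam mu)) {p | ¬ DeliversFrom i p.1 v p.2}

/-- The probability that a service that starts at time `0` fails to be completed by time `y`,
either because it takes longer or because a source other than `i` preempts it. Arrivals of
source `i` are ignored. -/
noncomputable def serviceFailure (lam : Fin N → ℝ) (mu : ℝ) (i : Fin N) (y : ℝ) : ENNReal :=
  ((expMeasure mu).prod (systemLaw lam mu))
    {p | ¬ (p.1 ≤ y ∧ ∀ j, j ≠ i → p.1 ≤ (p.2 j 0).1)}

theorem measurableSet_serviceSuccess (i : Fin N) :
    MeasurableSet {p : ℝ × ℝ × Config N | p.2.1 ≤ p.1 ∧ ∀ j, j ≠ i → p.2.1 ≤ (p.2.2 j 0).1} := by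
  refine MeasurableSet.inter (measurableSet_le (measurable_fst.comp measurable_snd)
    measurable_fst) ?_
  have h : MeasurableSet (⋂ j, {p : ℝ × ℝ × Config N | j ≠ i → p.2.1 ≤ (p.2.2 j 0).1}) :=
    .iInter fun j => (MeasurableSet.const _).imp
      (measurableSet_le (measurable_fst.comp measurable_snd) (by fun_prop))
  rw [← Set.ofPred_forall] at h
  exact h

section Renewal

variable {lam : Fin N → ℝ} {mu : ℝ}

theorem measurable_busySilence (hlam : ∀ j, 0 < lam j) (hmu : 0 < mu) (i : Fin N) :
    Measurable (busySilence lam mu i) := by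
  have := isProbabilityMeasure_systemLaw hlam hmu
  have := isProbabilityMeasure_expMeasure hmu
  exact measurable_measure_prodMk_left
    (((measurableSet_deliversFrom i).preimage
      (f := fun p : ℝ × ℝ × Config N => (p.2.1, p.1, p.2.2)) (by fun_prop)).compl)

theorem busySilence_le_one (hlam : ∀ j, 0 < lam j) (hmu : 0 < mu) (i : Fin N) (v : ℝ) :
    busySilence lam mu i v ≤ 1 := by
  have := isProbabilityMeasure_systemLaw hlam hmu
  have := isProbabilityMeasure_expMeasure hmu
  exact prob_le_one

theorem ae_service_pos_regular (hlam : ∀ j, 0 < lam j) (hmu : 0 < mu) :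
    ∀ᵐ p ∂(expMeasure mu).prod (systemLaw lam mu), 0 < p.1 ∧ Regular p.2 := by
  have := isProbabilityMeasure_systemLaw hlam hmu
  have := isProbabilityMeasure_expMeasure hmu
  have h1 := (measurePreserving_fst (μ := expMeasure mu)
    (ν := systemLaw lam mu)).quasiMeasurePreserving.ae (expMeasure_ae_pos hmu)
  have h2 := (measurePreserving_snd (μ := expMeasure mu)
    (ν := systemLaw lam mu)).quasiMeasurePreserving.ae (ae_regular hlam hmu)
  filter_upwards [h1, h2] with p h1 h2 using ⟨h1, h2⟩

theorem busySilence_of_neg (hlam : ∀ j, 0 < lam j) (hmu : 0 < mu) (i : Fin N) {v : ℝ}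
    (hv : v < 0) : busySilence lam mu i v = 1 := by
  have := isProbabilityMeasure_systemLaw hlam hmu
  have := isProbabilityMeasure_expMeasure hmu
  rw [busySilence, ← measure_univ (μ := (expMeasure mu).prod (systemLaw lam mu))]
  refine measure_congr ?_
  filter_upwards [ae_service_pos_regular hlam hmu] with p hp
  refine propext (iff_of_true ?_ trivial)
  rintro (⟨h, -⟩ | ⟨q, hq, -, h1, h2⟩)
  · linarith [hp.1]
  · have := hp.2.pts_pos hq
    linarith

theorem ae_restart_regular (hlam : ∀ j, 0 < lam j) (hmu : 0 < mu) (i : Fin N) :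
    ∀ᵐ p ∂((expMeasure (lam i)).prod (expMeasure mu)).prod
      ((systemLaw lam mu).prod (systemLaw lam mu)),
      0 < p.1.1 ∧ Regular p.2.1 ∧ Regular p.2.2 := by
  have := isProbabilityMeasure_systemLaw hlam hmu
  have := isProbabilityMeasure_expMeasure hmu
  have := isProbabilityMeasure_expMeasure (hlam i)
  have h1 := ((measurePreserving_fst (μ := expMeasure (lam i)) (ν := expMeasure mu)).comp
    (measurePreserving_fst (μ := (expMeasure (lam i)).prod (expMeasure mu))
      (ν := (systemLaw lam mu).prod (systemLaw lam mu)))).quasiMeasurePreserving.ae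
        (expMeasure_ae_pos (hlam i))
  have h2 := (measurePreserving_snd (μ := (expMeasure (lam i)).prod (expMeasure mu))
      (ν := (systemLaw lam mu).prod (systemLaw lam mu))).quasiMeasurePreserving.ae
        (ae_regular_prod hlam hmu)
  filter_upwards [h1, h2] with p h1 h2 using ⟨h1, h2⟩

/-- Disintegration of an event with respect to the first update of source `i`, when the past of
the other sources and the future system enter through separate conditions. -/
theorem systemLaw_eq_lintegral_restart (hlam : ∀ j, 0 < lam j) (hmu : 0 < mu) (i : Fin N)
    {A : Set (Config N)} {B C : Set (ℝ × ℝ × Config N)} (hA : MeasurableSet A)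
    (hB : MeasurableSet B) (hC : MeasurableSet C)
    (h : ∀ (e : ℝ × ℝ) (z z' : Config N), 0 < e.1 → Regular z → Regular z' →
      (restartAt i e z z' ∈ A ↔ (e.1, e.2, z) ∈ B ∧ (e.1, e.2, z') ∈ C)) :
    systemLaw lam mu A = ∫⁻ x, ∫⁻ s, systemLaw lam mu {z | (x, s, z) ∈ B} *
      systemLaw lam mu {z | (x, s, z) ∈ C} ∂expMeasure mu ∂expMeasure (lam i) := by
  have := isProbabilityMeasure_systemLaw hlam hmu
  have := isProbabilityMeasure_expMeasure hmu
  have := isProbabilityMeasure_expMeasure (hlam i)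
  have hB' := hB.preimage (f := fun p : (ℝ × ℝ) × Config N => (p.1.1, p.1.2, p.2)) (by fun_prop)
  have hC' := hC.preimage (f := fun p : (ℝ × ℝ) × Config N => (p.1.1, p.1.2, p.2)) (by fun_prop)
  rw [← (measurePreserving_restartAt hlam hmu i).measure_preimage hA.nullMeasurableSet]
  have h1 : (fun p : (ℝ × ℝ) × Config N × Config N => restartAt i p.1 p.2.1 p.2.2) ⁻¹' A
      =ᵐ[((expMeasure (lam i)).prod (expMeasure mu)).prod
        ((systemLaw lam mu).prod (systemLaw lam mu))]
      ((fun p : (ℝ × ℝ) × Config N × Config N => (p.1.1, p.1.2, p.2.1)) ⁻¹' B ∩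
        (fun p : (ℝ × ℝ) × Config N × Config N => (p.1.1, p.1.2, p.2.2)) ⁻¹' C : Set _) := by
    filter_upwards [ae_restart_regular hlam hmu i] with p hp
    exact propext (h p.1 p.2.1 p.2.2 hp.1 hp.2.1 hp.2.2)
  rw [measure_congr h1, Measure.prod_apply
    ((hB.preimage (by fun_prop)).inter (hC.preimage (by fun_prop)))]
  have h2 : ∀ e : ℝ × ℝ, ((systemLaw lam mu).prod (systemLaw lam mu)) (Prod.mk e ⁻¹'
      ((fun p : (ℝ × ℝ) × Config N × Config N => (p.1.1, p.1.2, p.2.1)) ⁻¹' B ∩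
        (fun p : (ℝ × ℝ) × Config N × Config N => (p.1.1, p.1.2, p.2.2)) ⁻¹' C)) =
      systemLaw lam mu {z | (e.1, e.2, z) ∈ B} * systemLaw lam mu {z | (e.1, e.2, z) ∈ C} := by
    intro e
    rw [← Measure.prod_prod]
    rfl
  rw [lintegral_congr h2, lintegral_prod]
  exact ((measurable_measure_prodMk_left hB').mul (measurable_measure_prodMk_left hC')).aemeasurable

theorem systemLaw_not_delivers_eq (hlam : ∀ j, 0 < lam j) (hmu : 0 < mu) (i : Fin N) (w : ℝ) :
    systemLaw lam mu {z | ¬ Delivers z i 0 w} =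
      ∫⁻ x, busySilence lam mu i (w - x) ∂expMeasure (lam i) := by
  have := isProbabilityMeasure_systemLaw hlam hmu
  have hD := measurableSet_deliversFrom i
  have hA : MeasurableSet {z : Config N | ¬ Delivers z i 0 w} :=
    (measurableSet_delivers_window i 0 w).compl
  rw [systemLaw_eq_lintegral_restart hlam hmu i (B := Set.univ)
    (C := {p | ¬ DeliversFrom i p.2.1 (w - p.1) p.2.2}) hA MeasurableSet.univ
    ((hD.preimage (f := fun p : ℝ × ℝ × Config N => (p.2.1, w - p.1, p.2.2))
      (by fun_prop)).compl)]
  · refine lintegral_congr fun x => ?_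
    have hC : MeasurableSet {p : ℝ × Config N | ¬ DeliversFrom i p.1 (w - x) p.2} :=
      (hD.preimage (f := fun p : ℝ × Config N => (p.1, w - x, p.2)) (by fun_prop)).compl
    rw [busySilence, Measure.prod_apply hC]
    refine lintegral_congr fun s => ?_
    have : {z : Config N | (x, s, z) ∈ (Set.univ : Set (ℝ × ℝ × Config N))} = Set.univ := by
      ext; simp
    rw [this, measure_univ, one_mul]
    rfl
  · intro e z z' he hz hz'
    have := not_congr (delivers_restartAt (i := i) (w := w) he hz hz')
    simpa using this

theorem busySilence_eq (hlam : ∀ j, 0 < lam j) (hmu : 0 < mu) (i : Fin N) (v : ℝ) :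
    busySilence lam mu i v =
      ∫⁻ x, serviceFailure lam mu i (min v x) * busySilence lam mu i (v - x)
        ∂expMeasure (lam i) := by
  have := isProbabilityMeasure_systemLaw hlam hmu
  have := isProbabilityMeasure_expMeasure hmu
  have := isProbabilityMeasure_expMeasure (hlam i)
  have hD := measurableSet_deliversFrom i
  have hG := measurableSet_serviceSuccess i
  have hA : ∀ s, MeasurableSet {z : Config N | ¬ DeliversFrom i s v z} := fun s =>
    (hD.preimage (f := fun z : Config N => (s, v, z)) (by fun_prop)).compl
  have hA' : ∀ v, MeasurableSet {p : ℝ × Config N | ¬ DeliversFrom i p.1 v p.2} := fun v =>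
    (hD.preimage (f := fun p : ℝ × Config N => (p.1, v, p.2)) (by fun_prop)).compl
  have hG' : ∀ y, MeasurableSet
      {p : ℝ × Config N | ¬ (p.1 ≤ y ∧ ∀ j, j ≠ i → p.1 ≤ (p.2 j 0).1)} := fun y =>
    (hG.preimage (f := fun p : ℝ × Config N => (y, p.1, p.2)) (by fun_prop)).compl
  have hfix : ∀ s, systemLaw lam mu {z | ¬ DeliversFrom i s v z} =
      ∫⁻ x, systemLaw lam mu {z | ¬ (s ≤ min v x ∧ ∀ j, j ≠ i → s ≤ (z j 0).1)} *
        busySilence lam mu i (v - x) ∂expMeasure (lam i) := by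
    intro s
    rw [systemLaw_eq_lintegral_restart hlam hmu i
      (B := {p | ¬ (s ≤ min v p.1 ∧ ∀ j, j ≠ i → s ≤ (p.2.2 j 0).1)})
      (C := {p | ¬ DeliversFrom i p.2.1 (v - p.1) p.2.2})
      (hA s)
      ((hG.preimage (f := fun p : ℝ × ℝ × Config N => (min v p.1, s, p.2.2))
        (by fun_prop)).compl)
      ((hD.preimage (f := fun p : ℝ × ℝ × Config N => (p.2.1, v - p.1, p.2.2))
        (by fun_prop)).compl)]
    · refine lintegral_congr fun x => ?_
      rw [busySilence, Measure.prod_apply (hA' (v - x)),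
        ← lintegral_const_mul' _ _ (measure_ne_top _ _)]
      rfl
    · intro e z z' he hz hz'
      exact (not_congr (deliversFrom_restartAt he hz hz')).trans not_or
  have hm2 : Measurable fun p : ℝ × ℝ =>
      systemLaw lam mu {z | ¬ (p.1 ≤ min v p.2 ∧ ∀ j, j ≠ i → p.1 ≤ (z j 0).1)} :=
    measurable_measure_prodMk_left ((hG.preimage
      (f := fun q : (ℝ × ℝ) × Config N => (min v q.1.2, q.1.1, q.2)) (by fun_prop)).compl)
  conv_lhs => rw [busySilence]
  rw [Measure.prod_apply (hA' v)]
  refine (lintegral_congr hfix).trans ?_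
  rw [lintegral_lintegral_swap]
  · refine lintegral_congr fun x => ?_
    have hmx : Measurable fun s =>
        systemLaw lam mu {z | ¬ (s ≤ min v x ∧ ∀ j, j ≠ i → s ≤ (z j 0).1)} :=
      hm2.comp (f := fun s : ℝ => (s, x)) (by fun_prop)
    rw [lintegral_mul_const _ hmx,
      serviceFailure, Measure.prod_apply (hG' (min v x))]
    rfl
  · exact (hm2.mul ((measurable_busySilence hlam hmu i).comp (f := fun p : ℝ × ℝ => v - p.2)
      (by fun_prop))).aemeasurable

theorem sourceLaw_first_ge {r : ℝ} (hr : 0 < r) (hmu : 0 < mu) {s : ℝ} (hs : 0 ≤ s) :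
    sourceLaw r mu {y | s ≤ (y 0).1} = ENNReal.ofReal (Real.exp (-(r * s))) := by
  have := isProbabilityMeasure_expMeasure hr
  have := isProbabilityMeasure_expMeasure hmu
  have h : MeasurePreserving (fun y : ℕ → ℝ × ℝ => (y 0).1) (sourceLaw r mu) (expMeasure r) :=
    measurePreserving_fst.comp
      (measurePreserving_eval_infinitePi (fun _ : ℕ => (expMeasure r).prod (expMeasure mu)) 0)
  rw [← expMeasure_Ici hr hs, ← h.measure_preimage measurableSet_Ici.nullMeasurableSet]
  rfl

/-- The other sources, together, preempt at rate `∑ j ≠ i, lam j`. -/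
theorem systemLaw_others_ge (hlam : ∀ j, 0 < lam j) (hmu : 0 < mu) (i : Fin N) {s : ℝ}
    (hs : 0 ≤ s) :
    systemLaw lam mu {z | ∀ j, j ≠ i → s ≤ (z j 0).1} =
      ENNReal.ofReal (Real.exp (-((∑ j ∈ Finset.univ.erase i, lam j) * s))) := by
  have := fun j => isProbabilityMeasure_sourceLaw (hlam j) hmu
  have h1 : {z : Config N | ∀ j, j ≠ i → s ≤ (z j 0).1} =
      Set.univ.pi fun j => if j = i then Set.univ else {y | s ≤ (y 0).1} := by
    ext z
    simp only [Set.mem_ofPred_eq, Set.mem_univ_pi]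
    refine forall_congr' fun j => ?_
    by_cases hj : j = i <;> simp [hj]
  rw [h1, systemLaw, Measure.pi_pi, ← Finset.mul_prod_erase _ _ (Finset.mem_univ i), if_pos rfl,
    measure_univ, one_mul, Finset.sum_mul, ← Finset.sum_neg_distrib, Real.exp_sum,
    ENNReal.ofReal_prod_of_nonneg fun _ _ => (Real.exp_pos _).le]
  refine Finset.prod_congr rfl fun j hj => ?_
  rw [if_neg (Finset.ne_of_mem_erase hj)]
  exact sourceLaw_first_ge (hlam j) hmu hs

theorem serviceFailure_toReal (hlam : ∀ j, 0 < lam j) (hmu : 0 < mu) (i : Fin N) {y : ℝ}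
    (hy : 0 ≤ y) {κ : ℝ} (hκ : κ = mu + ∑ j ∈ Finset.univ.erase i, lam j) :
    (serviceFailure lam mu i y).toReal = 1 - mu / κ * (1 - Real.exp (-(κ * y))) := by
  have := isProbabilityMeasure_systemLaw hlam hmu
  have := isProbabilityMeasure_expMeasure hmu
  have hκ0 : 0 < κ := by
    have : 0 ≤ ∑ j ∈ Finset.univ.erase i, lam j := Finset.sum_nonneg fun j _ => (hlam j).le
    linarith
  have hS : MeasurableSet {p : ℝ × Config N | p.1 ≤ y ∧ ∀ j, j ≠ i → p.1 ≤ (p.2 j 0).1} :=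
    (measurableSet_serviceSuccess i).preimage (f := fun p : ℝ × Config N => (y, p.1, p.2))
      (by fun_prop)
  have hcompl : (serviceFailure lam mu i y).toReal =
      1 - (((expMeasure mu).prod (systemLaw lam mu))
        {p | p.1 ≤ y ∧ ∀ j, j ≠ i → p.1 ≤ (p.2 j 0).1}).toReal := probReal_compl_eq_one_sub hS
  have hmeas : ((expMeasure mu).prod (systemLaw lam mu))
        {p | p.1 ≤ y ∧ ∀ j, j ≠ i → p.1 ≤ (p.2 j 0).1} =
      ∫⁻ s in Set.Ioc 0 y, ENNReal.ofReal (mu * Real.exp (-(κ * s))) := by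
    rw [Measure.prod_apply hS, lintegral_expMeasure _ (measurable_measure_prodMk_left hS),
      ← lintegral_indicator measurableSet_Ioi, ← lintegral_indicator measurableSet_Ioc]
    refine lintegral_congr fun s => ?_
    by_cases hs : 0 < s
    · rw [Set.indicator_of_mem (by exact hs)]
      by_cases hsy : s ≤ y
      · rw [Set.indicator_of_mem (show s ∈ Set.Ioc 0 y from ⟨hs, hsy⟩)]
        have h1 : Prod.mk s ⁻¹' {p : ℝ × Config N | p.1 ≤ y ∧ ∀ j, j ≠ i → p.1 ≤ (p.2 j 0).1} =
            {z | ∀ j, j ≠ i → s ≤ (z j 0).1} := by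
          ext z
          exact and_iff_right hsy
        rw [h1, systemLaw_others_ge hlam hmu i hs.le,
          ← ENNReal.ofReal_mul (by positivity), mul_assoc, ← Real.exp_add, hκ]
        congr 3
        ring
      · rw [Set.indicator_of_notMem (fun h => hsy h.2)]
        refine mul_eq_zero_of_right _ (measure_mono_null (fun z hz => hsy hz.1) measure_empty)
    · rw [Set.indicator_of_notMem (by exact hs), Set.indicator_of_notMem (fun h => hs h.1)]
  have hderiv : ∀ s ∈ Set.uIcc 0 y, HasDerivAt (fun s => -(mu / κ) * Real.exp (-(κ * s)))
      (mu * Real.exp (-(κ * s))) s := by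
    intro s _
    have h1 : HasDerivAt (fun s : ℝ => -(κ * s)) (-κ) s := by
      simpa using (hasDerivAt_id s).const_mul κ |>.fun_neg
    refine (h1.exp.const_mul (-(mu / κ))).congr_deriv ?_
    field_simp
  have hint : ∫ s in (0 : ℝ)..y, mu * Real.exp (-(κ * s)) = mu / κ * (1 - Real.exp (-(κ * y))) := by
    rw [intervalIntegral.integral_eq_sub_of_hasDerivAt hderiv
      (Continuous.intervalIntegrable (by fun_prop) _ _)]
    simp only [mul_zero, neg_zero, Real.exp_zero]
    ring
  rw [hcompl, hmeas, ← hint, intervalIntegral.integral_of_le hy,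
    integral_eq_lintegral_of_nonneg_ae (Eventually.of_forall fun s => by positivity)
      (by fun_prop)]

end Renewal

/-! ### Solving the renewal equations -/

theorem toReal_lintegral_expMeasure {r : ℝ} (hr : 0 < r) {φ : ℝ → ENNReal} (hφ : Measurable φ)
    (h1 : ∀ x, φ x ≤ 1) :
    (∫⁻ x, φ x ∂expMeasure r).toReal =
      ∫ x in Set.Ioi 0, r * Real.exp (-(r * x)) * (φ x).toReal := by
  have hm := hφ.ennreal_toReal
  rw [lintegral_expMeasure r hφ, integral_eq_lintegral_of_nonneg_ae
    (Eventually.of_forall fun x => by positivity)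
    (Measurable.aestronglyMeasurable (by fun_prop))]
  congr 1
  refine lintegral_congr fun x => ?_
  rw [ENNReal.ofReal_mul (p := r * Real.exp (-(r * x))) (by positivity),
    ENNReal.ofReal_toReal (ne_top_of_le_ne_top ENNReal.one_ne_top (h1 x))]

theorem integrableOn_exp_mul {r : ℝ} (hr : 0 < r) {h : ℝ → ℝ} (hm : Measurable h) {C : ℝ}
    (hC : ∀ x, |h x| ≤ C) :
    IntegrableOn (fun x => r * Real.exp (-(r * x)) * h x) (Set.Ioi 0) := by
  refine Integrable.mul_bdd (c := C) ?_ hm.aestronglyMeasurable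
    (Eventually.of_forall fun x => hC x)
  simp only [← neg_mul]
  exact (exp_neg_integrableOn_Ioi 0 hr).const_mul r

theorem integral_Ioi_exp_mul {r : ℝ} (hr : 0 < r) {h : ℝ → ℝ} (hm : Measurable h) {C : ℝ}
    (hC : ∀ x, |h x| ≤ C) {w c : ℝ} (hw : 0 ≤ w) (hc : ∀ x, w < x → h x = c) :
    ∫ x in Set.Ioi 0, r * Real.exp (-(r * x)) * h x =
      (∫ x in (0 : ℝ)..w, r * Real.exp (-(r * x)) * h x) + Real.exp (-(r * w)) * c := by
  have hint := integrableOn_exp_mul hr hm hC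
  rw [← Set.Ioc_union_Ioi_eq_Ioi hw, setIntegral_union Set.Ioc_disjoint_Ioi_same
    measurableSet_Ioi (hint.mono_set Set.Ioc_subset_Ioi_self)
    (hint.mono_set (Set.Ioi_subset_Ioi hw)), intervalIntegral.integral_of_le hw]
  congr 1
  rw [setIntegral_congr_fun (g := fun x => r * Real.exp (-r * x) * c) measurableSet_Ioi
    fun x hx => by simp only [hc x hx, neg_mul], integral_mul_const, integral_const_mul,
    integral_exp_mul_Ioi (by linarith)]
  rw [neg_mul]
  field_simp

/-- `e ^ (-k v) (1 + ∫₀ᵛ l e ^ (k y) q y dy)`, the solution of `R' = -k R + l q`, `R 0 = 1`. -/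
noncomputable def duhamel (l k : ℝ) (q : ℝ → ℝ) (v : ℝ) : ℝ :=
  Real.exp (-(k * v)) * (1 + ∫ y in (0 : ℝ)..v, l * Real.exp (k * y) * q y)

theorem duhamel_eq (l k : ℝ) (q : ℝ → ℝ) (v : ℝ) :
    duhamel l k q v =
      (∫ x in (0 : ℝ)..v, l * Real.exp (-(k * x)) * q (v - x)) + Real.exp (-(k * v)) := by
  have h := intervalIntegral.integral_comp_sub_left (a := 0) (b := v)
    (fun y => l * Real.exp (-(k * (v - y))) * q y) v
  simp only [sub_sub_cancel, sub_self, sub_zero] at h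
  rw [h, duhamel, mul_add, mul_one, add_comm, ← intervalIntegral.integral_const_mul]
  congr 1
  refine intervalIntegral.integral_congr fun y _ => ?_
  rw [show -(k * (v - y)) = -(k * v) + k * y by ring, Real.exp_add]
  ring

theorem duhamel_zero (l k : ℝ) (q : ℝ → ℝ) : duhamel l k q 0 = 1 := by simp [duhamel]

theorem duhamel_congr (l k : ℝ) {q q' : ℝ → ℝ} (h : ∀ v, 0 ≤ v → q v = q' v) {v : ℝ}
    (hv : 0 ≤ v) : duhamel l k q v = duhamel l k q' v := by
  rw [duhamel, duhamel]
  congr 2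
  refine intervalIntegral.integral_congr fun y hy => ?_
  rw [Set.uIcc_of_le hv] at hy
  simp only [h y hy.1]

theorem continuous_duhamel (l k : ℝ) {q : ℝ → ℝ} (hm : Measurable q) {C : ℝ}
    (hC : ∀ x, |q x| ≤ C) : Continuous (duhamel l k q) := by
  have hint : ∀ a b : ℝ, IntervalIntegrable (fun y => l * Real.exp (k * y) * q y) volume a b := by
    intro a b
    have h1 : IntervalIntegrable (fun y => l * Real.exp (k * y)) volume a b :=
      Continuous.intervalIntegrable (by fun_prop) _ _
    rw [intervalIntegrable_iff] at h1 ⊢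
    exact Integrable.mul_bdd (c := C) h1 hm.aestronglyMeasurable (Eventually.of_forall hC)
  unfold duhamel
  exact (by fun_prop : Continuous fun v : ℝ => Real.exp (-(k * v))).mul
    (continuous_const.add (intervalIntegral.continuous_primitive hint 0))

theorem hasDerivAt_duhamel (l k : ℝ) {q : ℝ → ℝ} (hq : Continuous q) (v : ℝ) :
    HasDerivAt (duhamel l k q) (-k * duhamel l k q v + l * q v) v := by
  have h1 : HasDerivAt (fun v : ℝ => Real.exp (-(k * v))) (Real.exp (-(k * v)) * -k) v := by
    have h0 : HasDerivAt (fun v : ℝ => -(k * v)) (-k) v := by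
      simpa using (hasDerivAt_id v).const_mul k |>.fun_neg
    exact h0.exp
  have h2 : HasDerivAt (fun v : ℝ => 1 + ∫ y in (0 : ℝ)..v, l * Real.exp (k * y) * q y)
      (l * Real.exp (k * v) * q v) v :=
    ((Continuous.integral_hasStrictDerivAt (by fun_prop) 0 v).hasDerivAt).const_add 1
  refine (h1.mul h2).congr_deriv ?_
  have h3 : Real.exp (-(k * v)) * Real.exp (k * v) = 1 := by
    rw [← Real.exp_add]; simp
  rw [duhamel]
  linear_combination l * q v * h3

theorem eq_exp_of_hasDerivAt {U : ℝ → ℝ} {c : ℝ} (h : ∀ v, 0 ≤ v → HasDerivAt U (c * U v) v)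
    {v : ℝ} (hv : 0 ≤ v) : U v = U 0 * Real.exp (c * v) := by
  have h1 : ∀ x, 0 ≤ x → HasDerivAt (fun x => U x * Real.exp (-(c * x))) 0 x := by
    intro x hx
    have h0 : HasDerivAt (fun v : ℝ => -(c * v)) (-c) x := by
      simpa using (hasDerivAt_id x).const_mul c |>.fun_neg
    refine ((h x hx).mul h0.exp).congr_deriv ?_
    ring
  have h2 := constant_of_has_deriv_right_zero (a := 0) (b := v)
    (fun x hx => (h1 x hx.1).continuousAt.continuousWithinAt)
    (fun x hx => (h1 x hx.1).hasDerivWithinAt) v ⟨hv, le_rfl⟩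
  simp only [mul_zero, neg_zero, Real.exp_zero, mul_one] at h2
  rw [← h2, mul_assoc, ← Real.exp_add]
  simp

/-- The renewal equations determine the probability of silence. They amount to the linear system
`p' = l B (r - p)`, `r' = l A p - (κ + l A) r` with `A = 1 - μ / κ`, `B = μ / κ`, whose
characteristic polynomial is `s ^ 2 + (l + κ) s + l μ`. -/
theorem renewal_solution {l mu κ a b : ℝ} (hκ : κ ≠ 0) (hab : a ≠ b) (hsum : a + b = -(l + κ))
    (hprod : a * b = l * mu) {p q : ℝ → ℝ} (hm : Measurable q) {C : ℝ} (hC : ∀ x, |q x| ≤ C)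
    (hp : ∀ v, 0 ≤ v →
      p v = (∫ x in (0 : ℝ)..v, l * Real.exp (-(l * x)) * q (v - x)) + Real.exp (-(l * v)))
    (hq : ∀ v, 0 ≤ v →
      q v = (∫ x in (0 : ℝ)..v, l * Real.exp (-(l * x)) *
          ((1 - mu / κ * (1 - Real.exp (-(κ * x)))) * q (v - x))) +
        Real.exp (-(l * v)) * (1 - mu / κ * (1 - Real.exp (-(κ * v)))))
    {v : ℝ} (hv : 0 ≤ v) :
    p v = (a * Real.exp (b * v) - b * Real.exp (a * v)) / (a - b) := by
  set q₁ : ℝ → ℝ := fun v =>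
    (1 - mu / κ) * duhamel l l q v + mu / κ * duhamel l (l + κ) q v with hq₁
  have hq₁c : Continuous q₁ :=
    (continuous_const.mul (continuous_duhamel l l hm hC)).add
      (continuous_const.mul (continuous_duhamel l (l + κ) hm hC))
  have hint : ∀ k v : ℝ,
      IntervalIntegrable (fun x => l * Real.exp (-(k * x)) * q (v - x)) volume 0 v := by
    intro k v
    have h1 : IntervalIntegrable (fun y => l * Real.exp (-(k * y))) volume 0 v :=
      Continuous.intervalIntegrable (by fun_prop) _ _
    rw [intervalIntegrable_iff] at h1 ⊢
    exact Integrable.mul_bdd (c := C) h1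
      (hm.comp (measurable_const.sub measurable_id)).aestronglyMeasurable
      (Eventually.of_forall fun x => hC _)
  -- The second equation says that `q` is a combination of two Duhamel integrals of itself.
  have hqq₁ : ∀ v, 0 ≤ v → q v = q₁ v := by
    intro v hv
    rw [hq v hv]
    simp only [hq₁]
    rw [duhamel_eq, duhamel_eq, mul_add, mul_add, ← intervalIntegral.integral_const_mul,
      ← intervalIntegral.integral_const_mul, add_add_add_comm,
      ← intervalIntegral.integral_add ((hint l v).const_mul _) ((hint (l + κ) v).const_mul _)]
    congr 1
    · refine intervalIntegral.integral_congr fun x _ => ?_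
      rw [show -((l + κ) * x) = -(l * x) + -(κ * x) by ring, Real.exp_add]
      ring
    · rw [show -((l + κ) * v) = -(l * v) + -(κ * v) by ring, Real.exp_add]
      ring
  set D : ℝ → ℝ := duhamel l l q₁ with hD
  set R : ℝ → ℝ := duhamel l (l + κ) q₁ with hR
  have hD0 : ∀ v, 0 ≤ v → duhamel l l q v = D v := fun v hv => duhamel_congr l l hqq₁ hv
  have hR0 : ∀ v, 0 ≤ v → duhamel l (l + κ) q v = R v := fun v hv =>
    duhamel_congr l (l + κ) hqq₁ hv
  have hclosed : ∀ v, 0 ≤ v → q₁ v = (1 - mu / κ) * D v + mu / κ * R v := by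
    intro v hv
    rw [← hD0 v hv, ← hR0 v hv]
  have hB : mu / κ * κ = mu := div_mul_cancel₀ _ hκ
  -- For either order of the roots, `U = D' - a D = l B (R - D) - a D` satisfies `U' = b U`.
  have heig : ∀ a b : ℝ, a + b = -(l + κ) → a * b = l * mu →
      l * (mu / κ) * (R v - D v) - a * D v = -a * Real.exp (b * v) := by
    intro a b hsum hprod
    have h := eq_exp_of_hasDerivAt (U := fun v => l * (mu / κ) * (R v - D v) - a * D v) (c := b)
      (fun x hx => by
        have hDx := hasDerivAt_duhamel l l hq₁c x
        have hRx := hasDerivAt_duhamel l (l + κ) hq₁c x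
        refine (((hRx.sub hDx).const_mul (l * (mu / κ))).sub (hDx.const_mul a)).congr_deriv ?_
        rw [hclosed x hx]
        simp only [← hD, ← hR]
        linear_combination (-(l * (mu / κ)) * (R x - D x)) * hsum + D x * hprod
          - l * D x * hB) hv
    have h0 : D 0 = 1 ∧ R 0 = 1 := ⟨duhamel_zero _ _ _, duhamel_zero _ _ _⟩
    simp only [h0.1, h0.2] at h
    rw [h]
    ring
  have h1 := heig a b hsum hprod
  have h2 := heig b a (by linarith) (by linarith)
  rw [hp v hv, ← duhamel_eq, hD0 v hv, eq_div_iff (sub_ne_zero.2 hab)]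
  linarith

/-! ### The probability of silence -/

theorem silenceProb_eq {N : ℕ} {lam : Fin N → ℝ} {mu : ℝ} (hlam : ∀ j, 0 < lam j) (hmu : 0 < mu)
    (i : Fin N) {a b : ℝ} (hab : a ≠ b) (hsum : a + b = -((∑ j, lam j) + mu))
    (hprod : a * b = lam i * mu) {w : ℝ} (hw : 0 ≤ w) :
    silenceProb lam mu i w = (a * Real.exp (b * w) - b * Real.exp (a * w)) / (a - b) := by
  have := isProbabilityMeasure_systemLaw hlam hmu
  have := isProbabilityMeasure_expMeasure hmu
  obtain ⟨κ, hκ⟩ : ∃ κ, κ = mu + ∑ j ∈ Finset.univ.erase i, lam j := ⟨_, rfl⟩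
  have hκ0 : 0 < κ := by
    have : 0 ≤ ∑ j ∈ Finset.univ.erase i, lam j := Finset.sum_nonneg fun j _ => (hlam j).le
    linarith
  have hlsum : (∑ j, lam j) + mu = lam i + κ := by
    rw [← Finset.add_sum_erase _ _ (Finset.mem_univ i), hκ]
    ring
  set q : ℝ → ℝ := fun v => (busySilence lam mu i v).toReal with hq
  have hqE := measurable_busySilence hlam hmu i
  have hqm : Measurable q := hqE.ennreal_toReal
  have hq0 : ∀ v, 0 ≤ q v := fun v => ENNReal.toReal_nonneg
  have hq1 : ∀ v, q v ≤ 1 := fun v =>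
    ENNReal.toReal_mono ENNReal.one_ne_top (busySilence_le_one hlam hmu i v)
  have hqabs : ∀ v, |q v| ≤ 1 := fun v => abs_le.2 ⟨by linarith [hq0 v], hq1 v⟩
  have hqneg : ∀ v, v < 0 → q v = 1 := fun v hv => by
    simp [hq, busySilence_of_neg hlam hmu i hv]
  have hgE : Measurable (serviceFailure lam mu i) :=
    measurable_measure_prodMk_left (measurableSet_serviceSuccess i).compl
  have hg1 : ∀ y, serviceFailure lam mu i y ≤ 1 := fun y => prob_le_one
  refine renewal_solution (l := lam i) (mu := mu) (κ := κ)
    (p := fun w => silenceProb lam mu i w) hκ0.ne' hab (by rw [hsum, hlsum]) hprod hqm hqabs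
    (fun v hv => ?_) (fun v hv => ?_) hw
  · have hhm : Measurable fun x => busySilence lam mu i (v - x) :=
      hqE.comp (measurable_const.sub measurable_id)
    rw [silenceProb, measureReal_def, systemLaw_not_delivers_eq hlam hmu i v,
      toReal_lintegral_expMeasure (hlam i) hhm fun x => busySilence_le_one hlam hmu i _,
      integral_Ioi_exp_mul (hlam i) (h := fun x => q (v - x)) (c := 1)
        (hqm.comp (measurable_const.sub measurable_id)) (fun x => hqabs _) hv
        (fun x hx => hqneg _ (by linarith)), mul_one]
  · have hhm : Measurable fun x =>
        serviceFailure lam mu i (min v x) * busySilence lam mu i (v - x) :=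
      (hgE.comp (measurable_const.min measurable_id)).mul
        (hqE.comp (measurable_const.sub measurable_id))
    have hh1 : ∀ x, serviceFailure lam mu i (min v x) * busySilence lam mu i (v - x) ≤ 1 :=
      fun x => mul_le_one' (hg1 _) (busySilence_le_one hlam hmu i _)
    have hhabs : ∀ x, |(serviceFailure lam mu i (min v x) * busySilence lam mu i (v - x)).toReal|
        ≤ 1 := fun x => by
      rw [abs_of_nonneg ENNReal.toReal_nonneg]
      exact ENNReal.toReal_mono ENNReal.one_ne_top (hh1 x)
    have h1 : q v = (∫⁻ x, serviceFailure lam mu i (min v x) * busySilence lam mu i (v - x)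
        ∂expMeasure (lam i)).toReal := by rw [← busySilence_eq hlam hmu i v]
    rw [h1, toReal_lintegral_expMeasure (hlam i) hhm hh1,
      integral_Ioi_exp_mul (hlam i) hhm.ennreal_toReal hhabs
        (c := 1 - mu / κ * (1 - Real.exp (-(κ * v)))) hv]
    · congr 1
      refine intervalIntegral.integral_congr fun x hx => ?_
      rw [Set.uIcc_of_le hv] at hx
      rw [ENNReal.toReal_mul, min_eq_right hx.2, serviceFailure_toReal hlam hmu i hx.1 hκ]
    · intro x hx
      rw [ENNReal.toReal_mul, min_eq_left hx.le, serviceFailure_toReal hlam hmu i hv hκ]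
      change _ * q (v - x) = _
      rw [hqneg _ (by linarith), mul_one]

/-! ### The density -/

/-- The density of the age, where `a`, `b` are the roots and `c` is their product. -/
noncomputable def agePDF (c a b x : ℝ) : ℝ :=
  if 0 ≤ x then c / (a - b) * (Real.exp (a * x) - Real.exp (b * x)) else 0

theorem agePDF_nonneg {c a b : ℝ} (hc : 0 ≤ c) (x : ℝ) : 0 ≤ agePDF c a b x := by
  unfold agePDF
  split_ifs with hx
  · rcases le_total a b with h | h
    · have h1 : Real.exp (a * x) ≤ Real.exp (b * x) :=
        Real.exp_le_exp.2 (mul_le_mul_of_nonneg_right h hx)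
      exact mul_nonneg_of_nonpos_of_nonpos
        (div_nonpos_of_nonneg_of_nonpos hc (by linarith)) (by linarith)
    · have h1 : Real.exp (b * x) ≤ Real.exp (a * x) :=
        Real.exp_le_exp.2 (mul_le_mul_of_nonneg_right h hx)
      exact mul_nonneg (div_nonneg hc (by linarith)) (by linarith)
  · exact le_rfl

theorem measurable_agePDF (c a b : ℝ) : Measurable (agePDF c a b) :=
  Measurable.ite measurableSet_Ici (by fun_prop) measurable_const

/-- The tail that belongs to the density. -/
theorem hasDerivAt_tail {c a b : ℝ} (hprod : a * b = c) (x : ℝ) :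
    HasDerivAt (fun w => -((a * Real.exp (b * w) - b * Real.exp (a * w)) / (a - b)))
      (c / (a - b) * (Real.exp (a * x) - Real.exp (b * x))) x := by
  have h : ∀ d : ℝ, HasDerivAt (fun w : ℝ => Real.exp (d * w)) (Real.exp (d * x) * d) x := by
    intro d
    have h0 : HasDerivAt (fun w : ℝ => d * w) d x := by
      simpa using (hasDerivAt_id x).const_mul d
    exact h0.exp
  refine ((((h b).const_mul a).sub ((h a).const_mul b)).div_const (a - b)).fun_neg.congr_deriv ?_
  rw [← hprod]
  ring

theorem tendsto_tail {a b : ℝ} (ha : a < 0) (hb : b < 0) :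
    Tendsto (fun w => -((a * Real.exp (b * w) - b * Real.exp (a * w)) / (a - b))) atTop
      (𝓝 0) := by
  have h : ∀ d : ℝ, d < 0 → Tendsto (fun w : ℝ => Real.exp (d * w)) atTop (𝓝 0) := fun d hd =>
    Real.tendsto_exp_atBot.comp (tendsto_id.const_mul_atTop_of_neg hd)
  simpa using ((((h b hb).const_mul a).sub ((h a ha).const_mul b)).div_const (a - b)).neg

theorem integrable_agePDF {c a b : ℝ} (ha : a < 0) (hb : b < 0) : Integrable (agePDF c a b) := by
  have h : ∀ d : ℝ, d < 0 → IntegrableOn (fun x : ℝ => Real.exp (d * x)) (Set.Ici 0) :=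
    fun d hd => by
      rw [integrableOn_Ici_iff_integrableOn_Ioi]
      simpa using exp_neg_integrableOn_Ioi 0 (neg_pos.2 hd)
  have h1 : agePDF c a b = (Set.Ici 0).indicator fun x =>
      c / (a - b) * (Real.exp (a * x) - Real.exp (b * x)) := by
    funext x
    simp only [agePDF, Set.indicator, Set.mem_Ici]
  rw [h1, integrable_indicator_iff measurableSet_Ici]
  exact ((h a ha).sub (h b hb)).const_mul _

theorem integral_Iic_agePDF_of_nonpos (c a b : ℝ) {x : ℝ} (hx : x ≤ 0) :
    ∫ y in Set.Iic x, agePDF c a b y = 0 := by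
  rw [setIntegral_congr_fun (g := fun _ => (0 : ℝ)) measurableSet_Iic fun y hy => ?_,
    integral_zero]
  have hyx : y ≤ x := hy
  simp only [agePDF]
  split_ifs with h0
  · have : y = 0 := by linarith
    simp [this]
  · rfl

theorem integral_Iic_agePDF {c a b : ℝ} (ha : a < 0) (hb : b < 0) (hab : a ≠ b)
    (hprod : a * b = c) {x : ℝ} (hx : 0 ≤ x) :
    ∫ y in Set.Iic x, agePDF c a b y =
      1 - (a * Real.exp (b * x) - b * Real.exp (a * x)) / (a - b) := by
  have hint := integrable_agePDF (c := c) ha hb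
  have h1 := intervalIntegral.integral_Iic_sub_Iic (f := agePDF c a b) (μ := volume)
    (a := 0) (b := x) hint.integrableOn hint.integrableOn
  have h2 : ∫ y in (0 : ℝ)..x, agePDF c a b y =
      ∫ y in (0 : ℝ)..x, c / (a - b) * (Real.exp (a * y) - Real.exp (b * y)) := by
    refine intervalIntegral.integral_congr fun y hy => ?_
    rw [Set.uIcc_of_le hx] at hy
    simp only [agePDF, if_pos hy.1]
  have hab' := sub_ne_zero.2 hab
  rw [integral_Iic_agePDF_of_nonpos c a b le_rfl, sub_zero, h2,
    intervalIntegral.integral_eq_sub_of_hasDerivAt (fun y _ => hasDerivAt_tail hprod y)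
      (Continuous.intervalIntegrable (by fun_prop) _ _)] at h1
  rw [h1]
  simp only [mul_zero, Real.exp_zero, mul_one, div_self hab']
  ring

theorem integral_agePDF {c a b : ℝ} (ha : a < 0) (hb : b < 0) (hab : a ≠ b)
    (hprod : a * b = c) : ∫ x, agePDF c a b x = 1 := by
  have h1 := (aecover_Iic (μ := volume) (l := atTop) (b := fun x : ℝ => x)
    tendsto_id).integral_tendsto_of_countably_generated (integrable_agePDF (c := c) ha hb)
  have h2 : Tendsto (fun x : ℝ => ∫ y in Set.Iic x, agePDF c a b y) atTop (𝓝 1) := by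
    have h3 := (tendsto_tail ha hb).const_add 1
    rw [add_zero] at h3
    refine h3.congr' ?_
    filter_upwards [eventually_ge_atTop 0] with x hx
    rw [integral_Iic_agePDF ha hb hab hprod hx]
    ring
  exact tendsto_nhds_unique h1 h2

end AoI

theorem mainTheorem4 {Ω : Type*} [MeasurableSpace Ω] (P : Measure Ω) [IsProbabilityMeasure P]
    {N : ℕ} (lam : Fin N → ℝ) (hlam : ∀ j, 0 < lam j) (mu : ℝ) (hmu : 0 < mu)
    (X S : Fin N → ℕ → Ω → ℝ) (hsys : AoI.IsMM11 P lam mu X S) (i : Fin N)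
    (a b : ℝ) (hab : a ≠ b)
    (ha : a ^ 2 + ((∑ j, lam j) + mu) * a + lam i * mu = 0)
    (hb : b ^ 2 + ((∑ j, lam j) + mu) * b + lam i * mu = 0) :
    (∀ w : ℝ, 0 < w →
      AoI.IsViolationProb P X S i w
        ((a * Real.exp (b * w) - b * Real.exp (a * w)) / (a - b))) ∧
    AoI.IsAgeDensity P X S i
      (fun x => if 0 ≤ x then lam i * mu / (a - b) * (Real.exp (a * x) - Real.exp (b * x))
        else 0) := by
  have hc : 0 < lam i * mu := mul_pos (hlam i) hmu
  have hk : 0 < (∑ j, lam j) + mu :=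
    add_pos_of_nonneg_of_pos (Finset.sum_nonneg fun j _ => (hlam j).le) hmu
  have hsum : a + b = -((∑ j, lam j) + mu) := by
    refine mul_left_cancel₀ (sub_ne_zero.2 hab) ?_
    linear_combination ha - hb
  have hprod : a * b = lam i * mu := by linear_combination a * hsum - ha
  have hneg : ∀ d : ℝ, d ^ 2 + ((∑ j, lam j) + mu) * d + lam i * mu = 0 → d < 0 := by
    intro d hd
    by_contra! h
    have h1 : 0 ≤ d ^ 2 + ((∑ j, lam j) + mu) * d := by positivity
    linarith
  refine ⟨fun w hw => ?_, ?_⟩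
  · rw [← AoI.silenceProb_eq hlam hmu i hab hsum hprod hw.le]
    exact hsys.isLongRunProb_age_gt hlam hmu i hw
  · change AoI.IsAgeDensity P X S i (AoI.agePDF (lam i * mu) a b)
    refine ⟨AoI.measurable_agePDF _ a b, AoI.agePDF_nonneg hc.le,
      AoI.integrable_agePDF (hneg a ha) (hneg b hb),
      AoI.integral_agePDF (hneg a ha) (hneg b hb) hab hprod, fun x => ?_⟩
    rcases le_or_gt x 0 with hx | hx
    · rw [AoI.integral_Iic_agePDF_of_nonpos _ a b hx]
      exact hsys.isLongRunProb_age_le_of_nonpos hlam hmu i hx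
    · rw [AoI.integral_Iic_agePDF (hneg a ha) (hneg b hb) hab hprod hx.le,
        ← AoI.silenceProb_eq hlam hmu i hab hsum hprod hx.le]
      exact hsys.isLongRunProb_age_le hlam hmu i hx
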